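/- **Definitions.** Let $b:\mathbb R^d\to\mathbb R^d$ be a Borel vector field and $T>0$. For an open set $U\subset\mathbb R^d$ put $V_U(x)=\max\{\mathrm{dist}(x,\mathbb R^d\setminus U)^{-1},|x|\}$ for $x\in U$ and $V_U(x)=\infty$ for $x\notin U$. The hitting time in $U$ of a curve $\eta:[0,\tau)\to\mathbb R^d$ is $\sup\{t\in[0,\tau):\sup_{[0,t]}V_U(\eta)<\infty\}$, understood as $0$ if $\eta(0)\notin U$. A *maximal regular flow* of $b$ on the time interval $(0,T)$ is a Borel map $T_X:\mathbb R^d\to(0,T]$ together with a Borel map $X(t,x)\in\mathbb R^d$, defined for $0\le t<T_X(x)$, such that 1. for Lebesgue-a.e. $x$, $X(0,x)=x$, $X(\cdot,x)$ is locally absolutely continuous on $[0,T_X(x))$, and $\frac{d}{dt}X(t,x)=b(X(t,x))$ for a.e. $t\in(0,T_X(x))$; 2. for every bounded open set $U$ there is a constant $C$ such that, for all $t\in[0,T]$, the push-forward under $X(t,\cdot)$ of Lebesgue measure restricted to $\{x: T_U(x)>t\}$ is at most $C$ times Lebesgue measure restricted to $U$, where $T_U(x)$ is the hitting time in $U$ of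 $X(\cdot,x)$; 3. $\limsup_{t\uparrow T_X(x)}|X(t,x)|=\infty$ for a.e. $x$ with $T_X(x)<T$. **Proposition.** Let $d\ge 3$. There exist an autonomous Borel vector field $b:\mathbb R^d\to\mathbb R^d$ and a Borel set $\Sigma\subset\mathbb R^d$ of positive Lebesgue measure such that $b\in W^{1,p}_{\rm loc}(\mathbb R^d;\mathbb R^d)$ for some $p>1$, the distributional divergence of $b$ is in $L^\infty_{\rm loc}(\mathbb R^d)$, and, for every $T>2$, $b$ has a maximal regular flow on $(0,T)$ with $$T_X(x)\le 2,\qquad \liminf_{t\uparrow T_X(x)}|X(t,x)|=0,\qquad \limsup_{t\uparrow T_X(x)}|X(t,x)|=\infty\qquad\text{for every }x\in\Sigma.$$ Moreover, for every $T>2$, every maximal regular flow of $b$ on $(0,T)$ has these three properties for a.e. $x\in\Sigma$. -/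

import Mathlib

open MeasureTheory Set Filter Topology
open scoped NNReal ENNReal

/-- The vector field `b` on `ℝ^d` belongs to `W^{1,p}_loc(ℝ^d; ℝ^d)`: it is in `L^p` on every compact
set, and it has a weak gradient `g` (with `g x v` the derivative at `x` in the direction `v`) which is
in `L^p` on every compact set. -/
def MemSobolevLoc {d : ℕ} (p : ℝ≥0∞)
    (b : EuclideanSpace ℝ (Fin d) → EuclideanSpace ℝ (Fin d)) : Prop :=
  (∀ K : Set (EuclideanSpace ℝ (Fin d)), IsCompact K → MemLp b p (volume.restrict K)) ∧
  ∃ g : EuclideanSpace ℝ (Fin d) → EuclideanSpace ℝ (Fin d) →L[ℝ] EuclideanSpace ℝ (Fin d),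
    (∀ K : Set (EuclideanSpace ℝ (Fin d)), IsCompact K → MemLp g p (volume.restrict K)) ∧
    ∀ φ : EuclideanSpace ℝ (Fin d) → ℝ, ContDiff ℝ (⊤ : ℕ∞) φ → HasCompactSupport φ →
      ∀ v : EuclideanSpace ℝ (Fin d),
        ∫ x, fderiv ℝ φ x v • b x = - ∫ x, φ x • g x v

/-- The distributional divergence of the (locally integrable) vector field `b` on `ℝ^d` is given by a
function in `L^∞_loc(ℝ^d)`. -/
def HasLocallyBoundedDiv {d : ℕ}
    (b : EuclideanSpace ℝ (Fin d) → EuclideanSpace ℝ (Fin d)) : Prop :=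
  ∃ δ : EuclideanSpace ℝ (Fin d) → ℝ,
    (∀ K : Set (EuclideanSpace ℝ (Fin d)), IsCompact K → MemLp δ ∞ (volume.restrict K)) ∧
    ∀ φ : EuclideanSpace ℝ (Fin d) → ℝ, ContDiff ℝ (⊤ : ℕ∞) φ → HasCompactSupport φ →
      ∫ x, fderiv ℝ φ x (b x) = - ∫ x, φ x * δ x

/-- The confining potential `V_Ω(x) = max (dist(x, ℝ^d \ Ω)⁻¹) |x|` of an open set `Ω`, extended by
the value `∞` outside `Ω` (for `Ω = ℝ^d` it is `|x|`). -/
noncomputable def confiningPotential {d : ℕ} (Ω : Set (EuclideanSpace ℝ (Fin d)))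
    (x : EuclideanSpace ℝ (Fin d)) : ℝ≥0∞ :=
  max (Metric.infEDist x Ωᶜ)⁻¹ ‖x‖ₑ

/-- The hitting time in the open set `Ω` of a curve `η : [0, τ) → ℝ^d`: the supremum of the
`t ∈ [0, τ)` such that `V_Ω ∘ η` is bounded on `[0, t]`. It is `0` if `η 0 ∉ Ω`, the set of such
`t` being empty in that case. -/
noncomputable def hittingTime {d : ℕ} (Ω : Set (EuclideanSpace ℝ (Fin d))) (τ : ℝ)
    (η : ℝ → EuclideanSpace ℝ (Fin d)) : ℝ :=
  sSup {t : ℝ | 0 ≤ t ∧ t < τ ∧ (⨆ s ∈ Icc 0 t, confiningPotential Ω (η s)) < ∞}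

/-- `X` is a maximal regular flow in `ℝ^d` relative to the vector field `b : (0, T) × ℝ^d → ℝ^d`,
with maximal existence time `τ : ℝ^d → (0, T]`. Only the values of `X t x` with `0 ≤ t < τ x`
matter. -/
structure IsMaximalRegularFlow {d : ℕ} (T : ℝ)
    (b : ℝ → EuclideanSpace ℝ (Fin d) → EuclideanSpace ℝ (Fin d))
    (X : ℝ → EuclideanSpace ℝ (Fin d) → EuclideanSpace ℝ (Fin d))
    (τ : EuclideanSpace ℝ (Fin d) → ℝ) : Prop where
  measurable_time : Measurable τ
  time_pos : ∀ x, 0 < τ x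
  time_le : ∀ x, τ x ≤ T
  measurable_flow : Measurable
    fun q : {q : ℝ × EuclideanSpace ℝ (Fin d) // 0 ≤ q.1 ∧ q.1 < τ q.2} => X q.1.1 q.1.2
  /-- For a.e. `x` the curve `X(·, x)` starts at `x`, is locally absolutely continuous on
  `[0, τ x)` and solves the ODE a.e. in `(0, τ x)`. -/
  integral_curve : ∀ᵐ x ∂(volume : Measure (EuclideanSpace ℝ (Fin d))),
    X 0 x = x ∧
    (∀ t, 0 ≤ t → t < τ x → AbsolutelyContinuousOnInterval (fun s => X s x) 0 t) ∧
    ∀ᵐ t ∂(volume.restrict (Ioo 0 (τ x))), HasDerivAt (fun s => X s x) (b t (X t x)) t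
  /-- Local bounded compression. -/
  bounded_compression : ∀ U : Set (EuclideanSpace ℝ (Fin d)), IsOpen U → Bornology.IsBounded U →
    ∃ C : ℝ≥0, ∀ t ∈ Icc 0 T,
      (volume.restrict {x | t < hittingTime U (τ x) fun s => X s x}).map (X t)
        ≤ C • volume.restrict U
  /-- Trajectories that end before the time `T` are unbounded. -/
  maximal : ∀ᵐ x ∂(volume : Measure (EuclideanSpace ℝ (Fin d))), τ x < T →
    limsup (fun t => ‖X t x‖ₑ) (𝓝[<] τ x) = ∞

/-!
The vector field lives in the half-space `{p | p 0 < 0}`, in a thin tube around the graph of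
`height x = x⁻¹ sin x⁻¹` over the first coordinate `x`. In the core of the tube the first coordinate
moves with unit speed, so a trajectory starting over `x ∈ (-1, 0)` reaches `x = 0` at time `-x`;
on the way it follows the axis of the tube, which oscillates faster and faster between height `0`
and larger and larger heights, while the other coordinates tend to `0`.

The width of the tube is `exp (-logWidth x)` with `logWidth' = height ^ 2`. This choice does two
things at once. The width is exponentially small in `|x|⁻¹`, so that it beats every power of
`|x|⁻¹` in the estimates of the field and its derivative: as the cross sections have dimension
`d - 1 ≥ 2`, the field is in `W^{1,4/3}_loc`, and the hyperplane `{p | p 0 = 0}` does not contribute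
to the weak derivative (`integral_fderiv_smul_eq_neg`). On the other hand the divergence of the
field is `-(d - 1) height ^ 2` times the speed (`trace_fieldDeriv`), and in the tube the height of
the axis differs from a coordinate of the point by a bounded amount: the divergence is locally
bounded, although the compression along a whole trajectory is infinite.

The flow is explicit. In the coordinates `chart` of the tube it is a translation of the first
variable, and Lebesgue measure has the density `exp (-(d - 1) logWidth x)`
(`lintegral_eq_lintegral_chart`). Along a piece of trajectory in a bounded set, `logWidth` has
bounded increase (`logWidth_sub_le`), which gives the local bounded compression
(`flow_compression`).

Any other maximal regular flow consists, for almost every starting point, of absolutely continuous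
solutions of the differential equation, whose right-hand side is smooth on `{p | p 0 < 0}`. Hence
it follows the explicit trajectory of a point of the core as long as both exist
(`eqOn_of_ae_hasDerivAt`), and the existence times agree, because a trajectory that ends before `T`
is unbounded (`eq_flow_of_isMaximalRegularFlow`).
-/

namespace OscillatingTube

/-! ### The profile functions -/

/-- The height `ζ(x) = x⁻¹ sin x⁻¹` of the axis of the tube over `x < 0`. -/
noncomputable def height (x : ℝ) : ℝ := x⁻¹ * Real.sin x⁻¹

/-- The derivative of `height`. -/
noncomputable def height' (x : ℝ) : ℝ := -(x⁻¹ ^ 2 * (Real.sin x⁻¹ + x⁻¹ * Real.cos x⁻¹))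

/-- The second derivative of `height`. -/
noncomputable def height'' (x : ℝ) : ℝ :=
  x⁻¹ ^ 2 * (2 * x⁻¹ * Real.sin x⁻¹ + 4 * x⁻¹ ^ 2 * Real.cos x⁻¹ - x⁻¹ ^ 3 * Real.sin x⁻¹)

/-- The primitive of `height ^ 2` whose exponential `exp (-logWidth x)` is the width of the tube
at `x < 0`. -/
noncomputable def logWidth (x : ℝ) : ℝ := -(x⁻¹ / 2 - Real.sin (2 * x⁻¹) / 4)

lemma hasDerivAt_height {x : ℝ} (hx : x ≠ 0) : HasDerivAt height (height' x) x := by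
  have h := hasDerivAt_inv hx
  have := h.mul h.sin
  refine this.congr_deriv ?_
  simp only [height']
  field_simp
  ring

lemma hasDerivAt_height' {x : ℝ} (hx : x ≠ 0) : HasDerivAt height' (height'' x) x := by
  have h := hasDerivAt_inv hx
  have := ((h.pow 2).mul (h.sin.add (h.mul h.cos))).neg
  refine this.congr_deriv ?_
  simp only [height'', Pi.mul_apply, Pi.add_apply, Pi.pow_apply, Nat.add_one_sub_one, pow_one,
    Nat.cast_ofNat]
  field_simp
  ring

lemma hasDerivAt_logWidth {x : ℝ} (hx : x ≠ 0) :
    HasDerivAt logWidth (height x ^ 2) x := by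
  have h := hasDerivAt_inv hx
  have := ((h.div_const 2).sub ((h.const_mul 2).sin.div_const 4)).neg
  refine this.congr_deriv ?_
  simp only [height]
  rw [Real.cos_two_mul, Real.cos_sq']
  field_simp
  ring

lemma measurable_height : Measurable height := by unfold height; fun_prop
lemma measurable_height' : Measurable height' := by unfold height'; fun_prop
lemma measurable_logWidth : Measurable logWidth := by unfold logWidth; fun_prop

lemma contDiffAt_height {x : ℝ} (hx : x ≠ 0) {n : WithTop ℕ∞} : ContDiffAt ℝ n height x :=
  (contDiffAt_inv ℝ hx).mul (Real.contDiff_sin.contDiffAt.comp x (contDiffAt_inv ℝ hx))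

lemma contDiffAt_height' {x : ℝ} (hx : x ≠ 0) {n : WithTop ℕ∞} : ContDiffAt ℝ n height' x := by
  have h := contDiffAt_inv ℝ hx (n := n)
  exact ((h.pow 2).mul ((Real.contDiff_sin.contDiffAt.comp x h).add
    (h.mul (Real.contDiff_cos.contDiffAt.comp x h)))).neg

lemma contDiffAt_logWidth {x : ℝ} (hx : x ≠ 0) {n : WithTop ℕ∞} :
    ContDiffAt ℝ n logWidth x := by
  have h := contDiffAt_inv ℝ hx (n := n)
  exact ((h.div_const 2).sub ((Real.contDiff_sin.contDiffAt.comp x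
    (contDiffAt_const.mul h)).div_const 4)).neg

lemma abs_height_le (x : ℝ) : |height x| ≤ 1 + |x⁻¹| := by
  rw [height, abs_mul]
  nlinarith [Real.abs_sin_le_one x⁻¹, abs_nonneg x⁻¹, abs_nonneg (Real.sin x⁻¹)]

lemma abs_height'_le (x : ℝ) : |height' x| ≤ (1 + |x⁻¹|) ^ 3 := by
  rw [height', abs_neg, abs_mul, abs_pow]
  have h0 := abs_nonneg x⁻¹
  have h1 : |Real.sin x⁻¹ + x⁻¹ * Real.cos x⁻¹| ≤ 1 + |x⁻¹| := by
    refine (abs_add_le _ _).trans ?_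
    rw [abs_mul]
    nlinarith [Real.abs_sin_le_one x⁻¹, Real.abs_cos_le_one x⁻¹]
  calc _ ≤ (1 + |x⁻¹|) ^ 2 * (1 + |x⁻¹|) := by gcongr; linarith
    _ = _ := by ring

lemma abs_height''_le (x : ℝ) : |height'' x| ≤ 7 * (1 + |x⁻¹|) ^ 5 := by
  rw [height'', abs_mul, abs_pow]
  set r := |x⁻¹| with hr
  have h0 : 0 ≤ r := abs_nonneg x⁻¹
  have h1 : |2 * x⁻¹ * Real.sin x⁻¹ + 4 * x⁻¹ ^ 2 * Real.cos x⁻¹ - x⁻¹ ^ 3 * Real.sin x⁻¹|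
      ≤ 2 * r + 4 * r ^ 2 + r ^ 3 := by
    refine (abs_sub _ _).trans ?_
    refine add_le_add ((abs_add_le _ _).trans (add_le_add ?_ ?_)) ?_
    · rw [abs_mul, abs_mul, abs_two]
      exact mul_le_of_le_one_right (by positivity) (Real.abs_sin_le_one _)
    · rw [abs_mul, abs_mul, abs_pow, abs_of_nonneg (by norm_num : (0:ℝ) ≤ 4)]
      exact mul_le_of_le_one_right (by positivity) (Real.abs_cos_le_one _)
    · rw [abs_mul, abs_pow]
      exact mul_le_of_le_one_right (by positivity) (Real.abs_sin_le_one _)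
  calc r ^ 2 * _ ≤ r ^ 2 * (2 * r + 4 * r ^ 2 + r ^ 3) := by gcongr
    _ ≤ (1 + r) ^ 2 * (7 * (1 + r) ^ 3) := by
      gcongr
      · linarith
      · nlinarith [pow_nonneg h0 2, pow_nonneg h0 3]
    _ = _ := by ring

lemma logWidth_lower {x : ℝ} (hx : x < 0) : |x⁻¹| / 2 - 1 / 4 ≤ logWidth x := by
  rw [abs_of_neg (inv_lt_zero.2 hx), logWidth]
  linarith [Real.neg_one_le_sin (2 * x⁻¹)]

lemma logWidth_nonneg {x : ℝ} (hx : x < 0) : 0 ≤ logWidth x := by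
  have h : 0 ≤ -(2 * x⁻¹) := by linarith [inv_lt_zero.2 hx]
  have := Real.sin_le h
  rw [Real.sin_neg] at this
  rw [logWidth]
  linarith

/-- Powers of `x⁻¹` are negligible compared with the inverse width of the tube. -/
lemma exists_pow_le_exp_logWidth (k : ℕ) :
    ∃ M : ℝ, 0 ≤ M ∧ ∀ x < 0, (1 + |x⁻¹|) ^ k ≤ M * Real.exp (logWidth x / 2) := by
  refine ⟨k.factorial * 4 ^ k * Real.exp (1 / 4 + 1 / 8), by positivity, fun x hx => ?_⟩
  have h0 : 0 ≤ (1 + |x⁻¹|) / 4 := by positivity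
  have h1 := Real.pow_div_factorial_le_exp _ h0 k
  have h2 : Real.exp ((1 + |x⁻¹|) / 4)
      ≤ Real.exp (1 / 4 + 1 / 8) * Real.exp (logWidth x / 2) := by
    rw [← Real.exp_add]
    exact Real.exp_le_exp.2 (by linarith [logWidth_lower hx])
  have h3 := h1.trans h2
  rw [div_le_iff₀ (by positivity), div_pow, div_le_iff₀ (by positivity)] at h3
  calc _ ≤ _ := h3
    _ = _ := by ring

/-! ### The tube and the vector field -/

/-- The space `ℝ^d` with `d = m + 3`. -/
abbrev Space (m : ℕ) := EuclideanSpace ℝ (Fin (m + 3))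

variable {m : ℕ}

/-- The axis of the tube: the graph of `height`, in the plane of the first two coordinates. -/
noncomputable def axis (x : ℝ) : Space m :=
  x • EuclideanSpace.single 0 1 + height x • EuclideanSpace.single 1 1

/-- The velocity of `axis`. -/
noncomputable def axis' (x : ℝ) : Space m :=
  EuclideanSpace.single 0 1 + height' x • EuclideanSpace.single 1 1

/-- The displacement of `p` from the point of the axis with the same first coordinate. -/
noncomputable def offset (p : Space m) : Space m := p - axis (p 0)

/-- The square of the distance to the axis, measured in units of the width of the tube. -/
noncomputable def relDistSq (p : Space m) : ℝ :=
  Real.exp (2 * logWidth (p 0)) * ‖offset p‖ ^ 2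

/-- A smooth cutoff which is `1` for `s ≤ 1` and `0` for `2 ≤ s`. -/
noncomputable def cutoff (s : ℝ) : ℝ := Real.smoothTransition (2 - s)

/-- The speed in the direction of the first coordinate. The tube lies over `x < 0`; the value `0` for
`0 ≤ p 0` discards the values of the profile functions there. -/
noncomputable def speed (p : Space m) : ℝ := if p 0 < 0 then cutoff (relDistSq p) else 0

/-- The velocity of the points which move with the tube, with unit speed in the first
coordinate. -/
noncomputable def drift (p : Space m) : Space m :=
  axis' (p 0) - height (p 0) ^ 2 • offset p

/-- The vector field. -/
noncomputable def field (p : Space m) : Space m := speed p • drift p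

lemma axis_zero (x : ℝ) : (axis x : Space m) 0 = x := by simp [axis]
lemma axis_one (x : ℝ) : (axis x : Space m) 1 = height x := by simp [axis]
lemma axis'_zero (x : ℝ) : (axis' x : Space m) 0 = 1 := by simp [axis']
lemma offset_zero (p : Space m) : offset p 0 = 0 := by simp [offset, axis_zero]
lemma drift_zero (p : Space m) : drift p 0 = 1 := by simp [drift, axis'_zero, offset_zero]

lemma cutoff_nonneg (s : ℝ) : 0 ≤ cutoff s := Real.smoothTransition.nonneg _
lemma cutoff_le_one (s : ℝ) : cutoff s ≤ 1 := Real.smoothTransition.le_one _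
lemma cutoff_eq_one {s : ℝ} (hs : s ≤ 1) : cutoff s = 1 :=
  Real.smoothTransition.one_of_one_le (by linarith)
lemma cutoff_eq_zero {s : ℝ} (hs : 2 ≤ s) : cutoff s = 0 :=
  Real.smoothTransition.zero_of_nonpos (by linarith)
lemma contDiff_cutoff {n : ℕ∞} : ContDiff ℝ n cutoff :=
  Real.smoothTransition.contDiff.comp (contDiff_const.sub contDiff_id)
lemma measurable_cutoff : Measurable cutoff :=
  (contDiff_cutoff (n := 0)).continuous.measurable

lemma speed_nonneg (p : Space m) : 0 ≤ speed p := by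
  unfold speed; split_ifs; exacts [cutoff_nonneg _, le_rfl]
lemma speed_le_one (p : Space m) : speed p ≤ 1 := by
  unfold speed; split_ifs; exacts [cutoff_le_one _, zero_le_one]

lemma speed_of_neg {p : Space m} (hp : p 0 < 0) : speed p = cutoff (relDistSq p) := if_pos hp
lemma speed_of_nonneg {p : Space m} (hp : 0 ≤ p 0) : speed p = 0 := if_neg hp.not_gt

lemma neg_of_speed_ne_zero {p : Space m} (h : speed p ≠ 0) : p 0 < 0 := by
  by_contra hp
  exact h (if_neg hp)

lemma relDistSq_lt_two {p : Space m} (h : speed p ≠ 0) : relDistSq p < 2 := by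
  by_contra hp
  exact h (by rw [speed_of_neg (neg_of_speed_ne_zero h), cutoff_eq_zero (not_lt.1 hp)])

/-- The radius of the tube at `x` is at most `2 exp (-logWidth x)`. -/
lemma norm_offset_le {p : Space m} (h : relDistSq p ≤ 2) :
    ‖offset p‖ ≤ 2 * Real.exp (-logWidth (p 0)) := by
  refine abs_le_of_sq_le_sq' ?_ (by positivity) |>.2
  have h1 : ‖offset p‖ ^ 2 = Real.exp (-logWidth (p 0)) ^ 2 * relDistSq p := by
    rw [relDistSq, ← mul_assoc, ← Real.exp_nat_mul, ← Real.exp_add]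
    norm_num
  rw [h1, mul_pow]
  nlinarith [sq_nonneg (Real.exp (-logWidth (p 0)))]

lemma norm_offset_le_two {p : Space m} (hp : p 0 < 0) (h : relDistSq p ≤ 2) :
    ‖offset p‖ ≤ 2 := by
  have := Real.exp_le_one_iff.2 (neg_nonpos.2 (logWidth_nonneg hp))
  linarith [norm_offset_le h]

/-- Inside the tube the height of the axis is controlled by the norm. -/
lemma abs_height_le_norm {p : Space m} (hp : p 0 < 0) (h : relDistSq p ≤ 2) :
    |height (p 0)| ≤ ‖p‖ + 2 := by
  have h1 : height (p 0) = p 1 - offset p 1 := by simp [offset, axis_one]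
  rw [h1]
  refine (abs_sub _ _).trans (add_le_add ?_ ?_)
  · exact PiLp.norm_apply_le p 1
  · exact (PiLp.norm_apply_le (offset p) 1).trans (norm_offset_le_two hp h)

lemma measurable_axis : Measurable (axis : ℝ → Space m) := by
  have := measurable_height
  unfold axis; fun_prop
lemma measurable_axis' : Measurable (axis' : ℝ → Space m) := by
  have := measurable_height'
  unfold axis'; fun_prop
lemma measurable_coord (i : Fin (m + 3)) : Measurable fun p : Space m => p i := by fun_prop
lemma measurable_offset : Measurable (offset : Space m → Space m) :=
  measurable_id.sub (measurable_axis.comp (measurable_coord 0))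
lemma measurable_relDistSq : Measurable (relDistSq : Space m → ℝ) :=
  ((measurable_logWidth.comp (measurable_coord 0)).const_mul 2).exp.mul
    (measurable_offset.norm.pow_const 2)
lemma measurable_speed : Measurable (speed : Space m → ℝ) :=
  Measurable.ite (measurableSet_lt (measurable_coord 0) measurable_const)
    (measurable_cutoff.comp measurable_relDistSq) measurable_const
lemma measurable_drift : Measurable (drift : Space m → Space m) :=
  (measurable_axis'.comp (measurable_coord 0)).sub
    (((measurable_height.comp (measurable_coord 0)).pow_const 2).smul measurable_offset)
lemma measurable_field : Measurable (field : Space m → Space m) :=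
  measurable_speed.smul measurable_drift

lemma contDiffAt_coord (i : Fin (m + 3)) {n : WithTop ℕ∞} (p : Space m) :
    ContDiffAt ℝ n (fun p : Space m => p i) p :=
  (EuclideanSpace.proj i : Space m →L[ℝ] ℝ).contDiff.contDiffAt

lemma contDiffAt_axis {x : ℝ} (hx : x ≠ 0) {n : WithTop ℕ∞} :
    ContDiffAt ℝ n (axis : ℝ → Space m) x :=
  (contDiffAt_id.smul contDiffAt_const).add ((contDiffAt_height hx).smul contDiffAt_const)

lemma contDiffAt_offset {p : Space m} (hp : p 0 ≠ 0) {n : WithTop ℕ∞} :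
    ContDiffAt ℝ n (offset : Space m → Space m) p :=
  contDiffAt_id.sub
    (ContDiffAt.comp (g := axis) (f := fun p : Space m => p 0) p (contDiffAt_axis hp)
      (contDiffAt_coord 0 p))

lemma contDiffAt_relDistSq {p : Space m} (hp : p 0 ≠ 0) {n : WithTop ℕ∞} :
    ContDiffAt ℝ n (relDistSq : Space m → ℝ) p :=
  ((contDiffAt_const.mul (ContDiffAt.comp (g := logWidth) (f := fun p : Space m => p 0) p
    (contDiffAt_logWidth hp) (contDiffAt_coord 0 p))).exp).mul ((contDiffAt_offset hp).norm_sq ℝ)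

lemma eventually_coord_neg {p : Space m} (hp : p 0 < 0) : ∀ᶠ q : Space m in 𝓝 p, q 0 < 0 :=
  (contDiffAt_coord (n := 0) 0 p).continuousAt.eventually_lt continuousAt_const hp

lemma contDiffAt_field {p : Space m} (hp : p 0 < 0) {n : ℕ∞} :
    ContDiffAt ℝ n (field : Space m → Space m) p := by
  have h1 : ContDiffAt ℝ n (fun q : Space m => cutoff (relDistSq q)) p :=
    contDiff_cutoff.contDiffAt.comp p (contDiffAt_relDistSq hp.ne)
  have h2 : ContDiffAt ℝ n (drift : Space m → Space m) p := by
    refine (contDiffAt_const.add ((ContDiffAt.comp (g := height') (f := fun p : Space m => p 0) p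
      (contDiffAt_height' hp.ne) (contDiffAt_coord 0 p)).smul contDiffAt_const)).sub
      (((ContDiffAt.comp (g := height) (f := fun p : Space m => p 0) p
      (contDiffAt_height hp.ne) (contDiffAt_coord 0 p)).pow 2).smul (contDiffAt_offset hp.ne))
  refine (h1.smul h2).congr_of_eventuallyEq ?_
  filter_upwards [eventually_coord_neg hp] with q hq
  rw [field, speed_of_neg hq, Pi.smul_apply']

/-! ### The derivative of the vector field -/

/-- The derivative of `offset`. -/
noncomputable def offsetDeriv (p : Space m) : Space m →L[ℝ] Space m :=
  ContinuousLinearMap.id ℝ _ -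
    (EuclideanSpace.proj 0 : Space m →L[ℝ] ℝ).smulRight (axis' (p 0))

/-- The derivative of `relDistSq`. -/
noncomputable def relDistSqDeriv (p : Space m) : Space m →L[ℝ] ℝ :=
  Real.exp (2 * logWidth (p 0)) •
    ((2 * height (p 0) ^ 2 * ‖offset p‖ ^ 2) • (EuclideanSpace.proj 0 : Space m →L[ℝ] ℝ) +
      2 • (innerSL ℝ (offset p)).comp (offsetDeriv p))

/-- The derivative of `drift`. -/
noncomputable def driftDeriv (p : Space m) : Space m →L[ℝ] Space m :=
  (EuclideanSpace.proj 0 : Space m →L[ℝ] ℝ).smulRight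
      (height'' (p 0) • EuclideanSpace.single 1 1
        - (2 * height (p 0) * height' (p 0)) • offset p) -
    height (p 0) ^ 2 • offsetDeriv p

/-- The derivative of `field` in `{p | p 0 < 0}`. -/
noncomputable def fieldDeriv (p : Space m) : Space m →L[ℝ] Space m :=
  cutoff (relDistSq p) • driftDeriv p +
    (deriv cutoff (relDistSq p) • relDistSqDeriv p).smulRight (drift p)

lemma hasDerivAt_axis {x : ℝ} (hx : x ≠ 0) : HasDerivAt (axis : ℝ → Space m) (axis' x) x := by
  have h1 : HasDerivAt (fun x : ℝ => x • (EuclideanSpace.single 0 1 : Space m))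
      (EuclideanSpace.single 0 1) x := by
    simpa using (hasDerivAt_id x).smul_const (EuclideanSpace.single 0 1 : Space m)
  exact h1.add ((hasDerivAt_height hx).smul_const _)

lemma hasFDerivAt_coord (p : Space m) : HasFDerivAt (fun q : Space m => q 0)
    (EuclideanSpace.proj 0 : Space m →L[ℝ] ℝ) p :=
  (EuclideanSpace.proj 0 : Space m →L[ℝ] ℝ).hasFDerivAt

lemma hasFDerivAt_offset {p : Space m} (hp : p 0 ≠ 0) :
    HasFDerivAt offset (offsetDeriv p) p := by
  have h := (hasDerivAt_axis (m := m) hp).hasFDerivAt.comp (f := fun q : Space m => q 0) p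
    (hasFDerivAt_coord p)
  refine ((hasFDerivAt_id p).sub h).congr_fderiv ?_
  ext v
  simp [offsetDeriv]

lemma hasFDerivAt_relDistSq {p : Space m} (hp : p 0 ≠ 0) :
    HasFDerivAt relDistSq (relDistSqDeriv p) p := by
  have h1 := (((hasDerivAt_logWidth hp).comp_hasFDerivAt (f := fun q : Space m => q 0) p
    (hasFDerivAt_coord p)).const_mul 2).exp.mul (hasFDerivAt_offset hp).norm_sq
  refine h1.congr_fderiv ?_
  ext v
  simp [relDistSqDeriv]
  ring

lemma hasFDerivAt_drift {p : Space m} (hp : p 0 ≠ 0) :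
    HasFDerivAt drift (driftDeriv p) p := by
  have h1 := (((hasDerivAt_height' hp).comp_hasFDerivAt (f := fun q : Space m => q 0) p
    (hasFDerivAt_coord p)).smul_const (EuclideanSpace.single 1 1 : Space m)).const_add
      (EuclideanSpace.single 0 1)
  have h2 := (((hasDerivAt_height hp).comp_hasFDerivAt (f := fun q : Space m => q 0) p
    (hasFDerivAt_coord p)).pow 2).smul (hasFDerivAt_offset hp)
  refine (h1.sub h2).congr_fderiv ?_
  ext v
  simp [driftDeriv]
  split_ifs <;> ring

lemma hasDerivAt_cutoff (s : ℝ) : HasDerivAt cutoff (deriv cutoff s) s :=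
  ((contDiff_cutoff (n := 1)).differentiable (by simp) s).hasDerivAt

lemma field_eventuallyEq {p : Space m} (hp : p 0 < 0) :
    field =ᶠ[𝓝 p] fun q => cutoff (relDistSq q) • drift q := by
  filter_upwards [eventually_coord_neg hp] with q hq
  rw [field, speed_of_neg hq]

lemma hasFDerivAt_field {p : Space m} (hp : p 0 < 0) :
    HasFDerivAt field (fieldDeriv p) p :=
  (((hasDerivAt_cutoff _).comp_hasFDerivAt p (hasFDerivAt_relDistSq hp.ne)).smul
    (hasFDerivAt_drift hp.ne)).congr_of_eventuallyEq (field_eventuallyEq hp)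

/-- The tube moves with the field: `relDistSq` is constant along `drift`. -/
lemma relDistSqDeriv_drift (p : Space m) : relDistSqDeriv p (drift p) = 0 := by
  have h : offsetDeriv p (drift p) = -(height (p 0) ^ 2 • offset p) := by
    simp [offsetDeriv, drift_zero]
    simp [drift]
  simp [relDistSqDeriv, h, drift_zero, inner_smul_right]
  ring

/-- The divergence of `field`: only the shrinking of the tube contributes. -/
lemma trace_fieldDeriv {p : Space m} (hp : p 0 < 0) :
    ∑ i, fieldDeriv p (EuclideanSpace.single i 1) i
      = -((m + 2) * height (p 0) ^ 2 * speed p) := by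
  have h1 : ∑ i, relDistSqDeriv p (EuclideanSpace.single i 1) * drift p i = 0 := by
    rw [← relDistSqDeriv_drift p]
    conv_rhs => rw [← (EuclideanSpace.basisFun (Fin (m + 3)) ℝ).sum_repr (drift p), map_sum]
    simp [mul_comm]
  have h2 : ∑ i, driftDeriv p (EuclideanSpace.single i 1) i = -((m + 2) * height (p 0) ^ 2) := by
    have h3 : ∀ i, driftDeriv p (EuclideanSpace.single i 1) i
        = (if i = 0 then (height (p 0) ^ 2 : ℝ) else 0) - height (p 0) ^ 2 := by
      intro i
      rcases eq_or_ne i 0 with rfl | hi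
      · simp [driftDeriv, offsetDeriv, offset_zero, axis'_zero]
      · simp [driftDeriv, offsetDeriv, hi, hi.symm]
    simp_rw [h3]
    rw [Finset.sum_sub_distrib]
    simp
    ring
  calc _ = cutoff (relDistSq p) * ∑ i, driftDeriv p (EuclideanSpace.single i 1) i
        + deriv cutoff (relDistSq p) *
          ∑ i, relDistSqDeriv p (EuclideanSpace.single i 1) * drift p i := by
        rw [Finset.mul_sum, Finset.mul_sum, ← Finset.sum_add_distrib]
        refine Finset.sum_congr rfl fun i _ => ?_
        simp [fieldDeriv]
        ring
    _ = _ := by rw [h1, h2, speed_of_neg hp]; ring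

/-! ### Size of the vector field and of its derivative -/

lemma deriv_smoothTransition_of_neg {s : ℝ} (hs : s < 0) : deriv Real.smoothTransition s = 0 := by
  rw [← deriv_const s (0 : ℝ)]
  refine Filter.EventuallyEq.deriv_eq ?_
  filter_upwards [gt_mem_nhds hs] with t ht
  exact Real.smoothTransition.zero_of_nonpos (le_of_lt ht)

lemma deriv_smoothTransition_of_one_lt {s : ℝ} (hs : 1 < s) :
    deriv Real.smoothTransition s = 0 := by
  rw [← deriv_const s (1 : ℝ)]
  refine Filter.EventuallyEq.deriv_eq ?_
  filter_upwards [lt_mem_nhds hs] with t ht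
  exact Real.smoothTransition.one_of_one_le (le_of_lt ht)

lemma exists_abs_deriv_smoothTransition_le :
    ∃ L : ℝ, 0 ≤ L ∧ ∀ s, |deriv Real.smoothTransition s| ≤ L := by
  have hc : Continuous (deriv Real.smoothTransition) :=
    (Real.smoothTransition.contDiff (n := 1)).continuous_deriv le_rfl
  have hs : HasCompactSupport (deriv Real.smoothTransition) := by
    refine HasCompactSupport.intro (isCompact_Icc (a := (0 : ℝ)) (b := 1)) fun s hs => ?_
    rcases lt_or_ge s 0 with h | h
    · exact deriv_smoothTransition_of_neg h
    · exact deriv_smoothTransition_of_one_lt (not_le.1 fun h' => hs ⟨h, h'⟩)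
  obtain ⟨L, hL⟩ := hc.bounded_above_of_compact_support hs
  exact ⟨L, (norm_nonneg _).trans (hL 0), hL⟩

lemma exists_abs_deriv_cutoff_le : ∃ L : ℝ, 0 ≤ L ∧ ∀ s, |deriv cutoff s| ≤ L := by
  obtain ⟨L, h0, hL⟩ := exists_abs_deriv_smoothTransition_le
  refine ⟨L, h0, fun s => ?_⟩
  have : deriv cutoff s = -deriv Real.smoothTransition (2 - s) :=
    deriv_comp_const_sub (f := Real.smoothTransition) 2 s
  rw [this, abs_neg]
  exact hL _

lemma deriv_cutoff_eq_zero {s : ℝ} (hs : 2 < s) : deriv cutoff s = 0 := by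
  rw [← deriv_const s (0 : ℝ)]
  refine Filter.EventuallyEq.deriv_eq ?_
  filter_upwards [lt_mem_nhds hs] with t ht
  exact cutoff_eq_zero (le_of_lt ht)

lemma norm_axis'_le (x : ℝ) : ‖(axis' x : Space m)‖ ≤ 2 * (1 + |x⁻¹|) ^ 3 := by
  have h1 : (1 : ℝ) ≤ (1 + |x⁻¹|) ^ 3 := one_le_pow₀ (by linarith [abs_nonneg x⁻¹])
  refine (norm_add_le _ _).trans ?_
  rw [norm_smul]
  simp only [PiLp.norm_single, norm_one, mul_one, Real.norm_eq_abs]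
  linarith [abs_height'_le x]

lemma height_sq_le (x : ℝ) : height x ^ 2 ≤ (1 + |x⁻¹|) ^ 2 := by
  rw [← sq_abs]; gcongr; exact abs_height_le x

lemma norm_drift_le {p : Space m} (hp : p 0 < 0) (h : relDistSq p ≤ 2) :
    ‖drift p‖ ≤ 4 * (1 + |(p 0)⁻¹|) ^ 3 := by
  have h1 := height_sq_le (p 0)
  have h2 : (1 + |(p 0)⁻¹|) ^ 2 ≤ (1 + |(p 0)⁻¹|) ^ 3 :=
    pow_le_pow_right₀ (by linarith [abs_nonneg (p 0)⁻¹]) (by norm_num)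
  refine (norm_sub_le _ _).trans ?_
  rw [norm_smul, Real.norm_of_nonneg (sq_nonneg _)]
  have := mul_le_mul h1 (norm_offset_le_two hp h) (norm_nonneg _) (by positivity)
  linarith [norm_axis'_le (m := m) (p 0)]

lemma norm_field_le {p : Space m} (hp : p 0 < 0) (h : relDistSq p ≤ 2) :
    ‖field p‖ ≤ 4 * (1 + |(p 0)⁻¹|) ^ 3 := by
  rw [field, norm_smul, Real.norm_of_nonneg (speed_nonneg p)]
  exact (mul_le_of_le_one_left (norm_nonneg _) (speed_le_one p)).trans (norm_drift_le hp h)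

lemma norm_offsetDeriv_apply_le (p v : Space m) :
    ‖offsetDeriv p v‖ ≤ 3 * (1 + |(p 0)⁻¹|) ^ 3 * ‖v‖ := by
  have h1 : (1 : ℝ) ≤ (1 + |(p 0)⁻¹|) ^ 3 := one_le_pow₀ (by linarith [abs_nonneg (p 0)⁻¹])
  have h2 : offsetDeriv p v = v - v 0 • axis' (p 0) := by simp [offsetDeriv]
  rw [h2]
  refine (norm_sub_le _ _).trans ?_
  rw [norm_smul]
  have h3 := mul_le_mul (PiLp.norm_apply_le v 0) (norm_axis'_le (m := m) (p 0)) (norm_nonneg _)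
    (norm_nonneg _)
  nlinarith [norm_nonneg v]

lemma abs_relDistSqDeriv_apply_le {p : Space m} (hp : p 0 < 0) (h : relDistSq p ≤ 2)
    (v : Space m) :
    |relDistSqDeriv p v| ≤ 16 * (1 + |(p 0)⁻¹|) ^ 3 * Real.exp (logWidth (p 0)) * ‖v‖ := by
  have h2 : 2 * Real.exp (2 * logWidth (p 0)) * ‖offset p‖ ≤ 4 * Real.exp (logWidth (p 0)) := by
    calc _ ≤ 2 * Real.exp (2 * logWidth (p 0)) * (2 * Real.exp (-logWidth (p 0))) := by
          gcongr; exact norm_offset_le h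
      _ = 4 * (Real.exp (2 * logWidth (p 0)) * Real.exp (-logWidth (p 0))) := by ring
      _ = _ := by rw [← Real.exp_add]; ring_nf
  have hA : 1 ≤ Real.exp (logWidth (p 0)) := Real.one_le_exp (logWidth_nonneg hp)
  have h3 := norm_offsetDeriv_apply_le p v
  have h4 := height_sq_le (p 0)
  set H := 1 + |(p 0)⁻¹| with hH
  have hH1 : 1 ≤ H := by linarith [abs_nonneg (p 0)⁻¹]
  have h1 : relDistSqDeriv p v = 2 * height (p 0) ^ 2 * relDistSq p * v 0
      + 2 * Real.exp (2 * logWidth (p 0)) * inner ℝ (offset p) (offsetDeriv p v) := by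
    simp [relDistSqDeriv, relDistSq]
    ring
  have h0 : 0 ≤ relDistSq p := by unfold relDistSq; positivity
  have h5 : |2 * height (p 0) ^ 2 * relDistSq p * v 0|
      ≤ 4 * H ^ 3 * Real.exp (logWidth (p 0)) * ‖v‖ := by
    rw [abs_mul, abs_of_nonneg (by positivity : 0 ≤ 2 * height (p 0) ^ 2 * relDistSq p)]
    calc _ ≤ 2 * H ^ 2 * 2 * ‖v‖ := by gcongr; exact PiLp.norm_apply_le v 0
      _ ≤ 2 * H ^ 3 * 2 * ‖v‖ := by gcongr; norm_num
      _ ≤ 2 * H ^ 3 * 2 * ‖v‖ * Real.exp (logWidth (p 0)) :=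
        le_mul_of_one_le_right (by positivity) hA
      _ = _ := by ring
  have h6 : |2 * Real.exp (2 * logWidth (p 0)) * inner ℝ (offset p) (offsetDeriv p v)|
      ≤ 12 * H ^ 3 * Real.exp (logWidth (p 0)) * ‖v‖ := by
    rw [abs_mul, abs_of_nonneg (by positivity)]
    calc _ ≤ 2 * Real.exp (2 * logWidth (p 0)) * (‖offset p‖ * ‖offsetDeriv p v‖) := by
          gcongr; exact abs_real_inner_le_norm _ _
      _ = 2 * Real.exp (2 * logWidth (p 0)) * ‖offset p‖ * ‖offsetDeriv p v‖ := by ring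
      _ ≤ 4 * Real.exp (logWidth (p 0)) * (3 * H ^ 3 * ‖v‖) := by gcongr
      _ = _ := by ring
  rw [h1]
  refine (abs_add_le _ _).trans ((add_le_add h5 h6).trans_eq (by ring))

lemma norm_driftDeriv_apply_le {p : Space m} (hp : p 0 < 0) (h : relDistSq p ≤ 2)
    (v : Space m) : ‖driftDeriv p v‖ ≤ 14 * (1 + |(p 0)⁻¹|) ^ 5 * ‖v‖ := by
  have h1 : driftDeriv p v = v 0 • (height'' (p 0) • EuclideanSpace.single 1 1
        - (2 * height (p 0) * height' (p 0)) • offset p)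
      - height (p 0) ^ 2 • offsetDeriv p v := by simp [driftDeriv]
  have h2 := norm_offset_le_two hp h
  have h3 := norm_offsetDeriv_apply_le p v
  have h4 := height_sq_le (p 0)
  have h5 := abs_height_le (p 0)
  have h6 := abs_height'_le (p 0)
  have h7 := abs_height''_le (p 0)
  have h8 : ‖v 0‖ ≤ ‖v‖ := PiLp.norm_apply_le v 0
  set H := 1 + |(p 0)⁻¹| with hH
  have hH1 : 1 ≤ H := by linarith [abs_nonneg (p 0)⁻¹]
  have h9 : ‖height'' (p 0) • (EuclideanSpace.single 1 1 : Space m)‖ ≤ 7 * H ^ 5 := by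
    simpa [norm_smul] using h7
  have h10 : ‖(2 * height (p 0) * height' (p 0)) • offset p‖ ≤ 4 * H ^ 5 := by
    rw [norm_smul, Real.norm_eq_abs, abs_mul, abs_mul, abs_two]
    calc _ ≤ 2 * H * H ^ 3 * 2 := by gcongr
      _ = 4 * H ^ 4 := by ring
      _ ≤ 4 * H ^ 5 := by gcongr; norm_num
  have h11 : ‖height (p 0) ^ 2 • offsetDeriv p v‖ ≤ 3 * H ^ 5 * ‖v‖ := by
    rw [norm_smul, Real.norm_of_nonneg (sq_nonneg _)]
    calc _ ≤ H ^ 2 * (3 * H ^ 3 * ‖v‖) := by gcongr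
      _ = _ := by ring
  rw [h1]
  calc _ ≤ ‖v 0‖ * (‖height'' (p 0) • (EuclideanSpace.single 1 1 : Space m)‖
          + ‖(2 * height (p 0) * height' (p 0)) • offset p‖)
          + ‖height (p 0) ^ 2 • offsetDeriv p v‖ := by
        refine (norm_sub_le _ _).trans ?_
        rw [norm_smul]
        gcongr
        exact norm_sub_le _ _
    _ ≤ ‖v‖ * (7 * H ^ 5 + 4 * H ^ 5) + 3 * H ^ 5 * ‖v‖ := by gcongr
    _ = _ := by ring

/-- The derivative of the field is bounded by the inverse width of the tube, up to a power of
the inverse of the first coordinate. -/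
lemma exists_norm_fieldDeriv_le : ∃ L : ℝ, 0 ≤ L ∧ ∀ p : Space m, p 0 < 0 → relDistSq p ≤ 2 →
    ‖fieldDeriv p‖ ≤ L * (1 + |(p 0)⁻¹|) ^ 6 * Real.exp (logWidth (p 0)) := by
  obtain ⟨L, hL0, hL⟩ := exists_abs_deriv_cutoff_le
  refine ⟨64 * L + 14, by positivity, fun p hp h => ?_⟩
  refine ContinuousLinearMap.opNorm_le_bound _ (by positivity) fun v => ?_
  have h1 : fieldDeriv p v = cutoff (relDistSq p) • driftDeriv p v
      + (deriv cutoff (relDistSq p) * relDistSqDeriv p v) • drift p := by simp [fieldDeriv]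
  have h2 := norm_driftDeriv_apply_le hp h v
  have h3 := abs_relDistSqDeriv_apply_le hp h v
  have h4 := norm_drift_le hp h
  have hA : 1 ≤ Real.exp (logWidth (p 0)) := Real.one_le_exp (logWidth_nonneg hp)
  set H := 1 + |(p 0)⁻¹| with hH
  have hH1 : 1 ≤ H := by linarith [abs_nonneg (p 0)⁻¹]
  rw [h1]
  calc _ ≤ ‖driftDeriv p v‖ + L * |relDistSqDeriv p v| * ‖drift p‖ := by
        refine (norm_add_le _ _).trans (add_le_add ?_ ?_)
        · rw [norm_smul, Real.norm_of_nonneg (cutoff_nonneg _)]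
          exact mul_le_of_le_one_left (norm_nonneg _) (cutoff_le_one _)
        · rw [norm_smul, Real.norm_eq_abs, abs_mul]
          gcongr
          exact hL _
    _ ≤ 14 * H ^ 5 * ‖v‖ + L * (16 * H ^ 3 * Real.exp (logWidth (p 0)) * ‖v‖) * (4 * H ^ 3) := by
        gcongr
    _ ≤ 14 * H ^ 6 * ‖v‖ * Real.exp (logWidth (p 0))
        + L * (16 * H ^ 3 * Real.exp (logWidth (p 0)) * ‖v‖) * (4 * H ^ 3) := by
        refine add_le_add_left (le_trans ?_ (le_mul_of_one_le_right (by positivity) hA)) _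
        gcongr
        norm_num
    _ = _ := by ring

lemma field_eq_zero {p : Space m} (h : 2 ≤ relDistSq p) : field p = 0 := by
  unfold field speed
  split_ifs
  · rw [cutoff_eq_zero h, zero_smul]
  · rw [zero_smul]

lemma field_of_nonneg {p : Space m} (hp : 0 ≤ p 0) : field p = 0 := by
  rw [field, speed_of_nonneg hp, zero_smul]

lemma fieldDeriv_eq_zero {p : Space m} (h : 2 < relDistSq p) : fieldDeriv p = 0 := by
  rw [fieldDeriv, cutoff_eq_zero h.le, deriv_cutoff_eq_zero h]
  ext; simp

/-! ### Lebesgue measure in the coordinates of the tube -/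

/-- The inclusion of the hyperplane of the last `d - 1` coordinates. -/
noncomputable def crossSection (u : Fin (m + 2) → ℝ) : Space m :=
  WithLp.toLp 2 (Fin.cons (α := fun _ => ℝ) 0 u)

/-- The coordinates of the tube: `chart x u` is the point over `x` whose displacement from the
axis is `u`, measured in units of the width of the tube. -/
noncomputable def chart (x : ℝ) (u : Fin (m + 2) → ℝ) : Space m :=
  axis x + Real.exp (-logWidth x) • crossSection u

lemma crossSection_zero (u : Fin (m + 2) → ℝ) : crossSection u 0 = 0 := by simp [crossSection]
lemma chart_zero (x : ℝ) (u : Fin (m + 2) → ℝ) : chart x u 0 = x := by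
  simp [chart, crossSection_zero, axis_zero]
lemma offset_chart (x : ℝ) (u : Fin (m + 2) → ℝ) :
    offset (chart x u) = Real.exp (-logWidth x) • crossSection u := by
  rw [offset, chart_zero, chart, add_sub_cancel_left]
lemma relDistSq_chart (x : ℝ) (u : Fin (m + 2) → ℝ) :
    relDistSq (chart x u) = ‖crossSection u‖ ^ 2 := by
  rw [relDistSq, offset_chart, chart_zero, norm_smul, mul_pow, ← mul_assoc,
    Real.norm_of_nonneg (Real.exp_nonneg _), ← Real.exp_nat_mul, ← Real.exp_add]
  norm_num

lemma continuous_crossSection : Continuous (crossSection : (Fin (m + 2) → ℝ) → Space m) := by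
  refine (PiLp.continuous_toLp 2 _).comp (continuous_pi fun i => ?_)
  refine Fin.cases ?_ (fun j => ?_) i
  · simpa using continuous_const
  · simpa using continuous_apply j

lemma measurable_chart : Measurable fun q : ℝ × (Fin (m + 2) → ℝ) => chart q.1 q.2 :=
  (measurable_axis.comp measurable_fst).add
    ((measurable_logWidth.comp measurable_fst).neg.exp.smul
      (continuous_crossSection.measurable.comp measurable_snd))

lemma lintegral_eq_lintegral_cons {f : Space m → ℝ≥0∞} (hf : Measurable f) :
    ∫⁻ p, f p = ∫⁻ x : ℝ, ∫⁻ u : Fin (m + 2) → ℝ,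
      f (WithLp.toLp 2 (Fin.cons (α := fun _ => ℝ) x u)) := by
  rw [← (PiLp.volume_preserving_toLp (Fin (m + 3))).lintegral_comp hf]
  have h := (volume_preserving_piFinSuccAbove (fun _ : Fin (m + 3) => ℝ) 0).symm
  have hf' : Measurable fun w : Fin (m + 3) → ℝ => f (WithLp.toLp 2 w) := by fun_prop
  rw [← h.lintegral_comp hf', Measure.volume_eq_prod, lintegral_prod]
  · simp [MeasurableEquiv.piFinSuccAbove, Fin.consEquiv]
  · exact (hf'.comp (MeasurableEquiv.measurable _)).aemeasurable

lemma lintegral_eq_lintegral_add_smul {n : ℕ} {g : (Fin n → ℝ) → ℝ≥0∞} (hg : Measurable g)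
    (c : Fin n → ℝ) {a : ℝ} (ha : 0 < a) :
    ∫⁻ u, g u = ∫⁻ u, ENNReal.ofReal (a ^ n) * g (c + a • u) := by
  have hg' : Measurable fun u => g (c + u) := by fun_prop
  rw [lintegral_const_mul _ (by fun_prop), ← lintegral_add_left_eq_self g c]
  have h1 : ∫⁻ u, g (c + a • u) = ∫⁻ u, g (c + u) ∂(Measure.map (a • ·) volume) :=
    (lintegral_map (f := fun u => g (c + u)) hg' (measurable_const_smul a)).symm
  rw [h1, Measure.map_addHaar_smul _ ha.ne', lintegral_smul_measure, smul_eq_mul, ← mul_assoc,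
    ← ENNReal.ofReal_mul (by positivity), Module.finrank_fin_fun, abs_of_nonneg (by positivity),
    mul_inv_cancel₀ (by positivity), ENNReal.ofReal_one, one_mul]

/-- The volume formula in the coordinates of the tube. -/
lemma lintegral_eq_lintegral_chart {f : Space m → ℝ≥0∞} (hf : Measurable f)
    (h0 : ∀ p, 0 ≤ p 0 → f p = 0) :
    ∫⁻ p, f p = ∫⁻ x in Iio (0 : ℝ), ∫⁻ u : Fin (m + 2) → ℝ,
      ENNReal.ofReal (Real.exp (-((m + 2) * logWidth x))) * f (chart x u) := by
  rw [lintegral_eq_lintegral_cons hf, ← lintegral_indicator measurableSet_Iio]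
  refine lintegral_congr fun x => ?_
  by_cases hx : x < 0
  · rw [indicator_of_mem (mem_Iio.2 hx), lintegral_eq_lintegral_add_smul
      (g := fun u => f (WithLp.toLp 2 (Fin.cons (α := fun _ => ℝ) x u))) ?_
      (Pi.single 0 (height x)) (Real.exp_pos (-logWidth x))]
    · refine lintegral_congr fun u => ?_
      congr 2
      · rw [← Real.exp_nat_mul]
        push_cast
        ring_nf
      · ext i
        refine Fin.cases ?_ (fun j => ?_) i
        · simp [chart, axis_zero, crossSection_zero]
        · have h2 : (Pi.single 0 (height x) : Fin (m + 2) → ℝ) j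
              = if j.succ = (1 : Fin (m + 3)) then height x else 0 := by
            rw [Pi.single_apply]
            congr 1
            rw [← Fin.succ_zero_eq_one, Fin.succ_inj]
          simp [chart, axis, crossSection, h2]
    · refine hf.comp ((WithLp.measurable_toLp 2 _).comp (measurable_pi_lambda _ fun i => ?_))
      refine Fin.cases ?_ (fun j => ?_) i
      · simp
      · simp only [Fin.cons_succ]; exact measurable_pi_apply j
  · rw [indicator_of_notMem (by simpa using hx)]
    simp [h0 _ (show 0 ≤ (WithLp.toLp 2 (Fin.cons (α := fun _ => ℝ) x _) : Space m) 0 by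
      simp only [Fin.cons_zero]; exact not_lt.1 hx)]

/-! ### Local integrability -/

/-- The inverse square of the width on the tube, the model for all the local integrability
statements. -/
noncomputable def weight (p : Space m) : ℝ≥0∞ :=
  {p : Space m | p 0 < 0 ∧ relDistSq p ≤ 2}.indicator
    (fun p => ENNReal.ofReal (Real.exp (2 * logWidth (p 0)))) p

lemma measurableSet_tube : MeasurableSet {p : Space m | p 0 < 0 ∧ relDistSq p ≤ 2} :=
  (measurableSet_lt (measurable_coord 0) measurable_const).inter
    (measurableSet_le measurable_relDistSq measurable_const)

lemma measurable_weight : Measurable (weight : Space m → ℝ≥0∞) :=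
  (ENNReal.measurable_ofReal.comp
    ((measurable_logWidth.comp (measurable_coord 0)).const_mul 2).exp).indicator
    measurableSet_tube

/-- `weight` is locally integrable. The cross sections of the tube have codimension one, so their
measure is the power `d - 1 ≥ 2` of the width: this is where `d ≥ 3` is used. -/
lemma lintegral_weight_lt_top {K : Set (Space m)} (hK : IsCompact K) :
    ∫⁻ p in K, weight p < ∞ := by
  obtain ⟨R, hR⟩ := hK.isBounded.exists_norm_le
  set D : Set (Fin (m + 2) → ℝ) := {u | ‖crossSection u‖ ^ 2 ≤ 2} with hD
  have hDm : MeasurableSet D :=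
    (isClosed_le (continuous_crossSection.norm.pow 2) continuous_const).measurableSet
  have hDv : volume D < ∞ := by
    refine (Metric.isBounded_closedBall (x := (0 : Fin (m + 2) → ℝ)) (r := 2)).subset ?_
      |>.measure_lt_top
    intro u hu
    rw [mem_closedBall_zero_iff, pi_norm_le_iff_of_nonneg zero_le_two]
    intro i
    have h1 : ‖u i‖ ≤ ‖crossSection u‖ := by
      simpa [crossSection] using PiLp.norm_apply_le (crossSection u) i.succ
    have h2 : ‖crossSection u‖ ≤ 2 := by
      have : ‖crossSection u‖ ^ 2 ≤ 2 := hu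
      nlinarith [norm_nonneg (crossSection u)]
    exact h1.trans h2
  set f : Space m → ℝ≥0∞ := {p : Space m | -R ≤ p 0}.indicator weight with hf
  have hfm : Measurable f :=
    measurable_weight.indicator (measurableSet_le measurable_const (measurable_coord 0))
  have hle : ∀ x < 0, ∀ u : Fin (m + 2) → ℝ,
      ENNReal.ofReal (Real.exp (-((m + 2) * logWidth x))) * f (chart x u)
        ≤ (Icc (-R) 0).indicator 1 x * D.indicator 1 u := by
    intro x hx u
    by_cases h1 : -R ≤ x
    · by_cases h2 : u ∈ D
      · have hm : chart x u ∈ {p : Space m | p 0 < 0 ∧ relDistSq p ≤ 2} :=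
          ⟨by rwa [chart_zero], by rw [relDistSq_chart]; exact h2⟩
        rw [hf, indicator_of_mem (by simpa [chart_zero] using h1), weight, indicator_of_mem hm,
          indicator_of_mem (show x ∈ Icc (-R) 0 from ⟨h1, hx.le⟩), indicator_of_mem h2,
          ← ENNReal.ofReal_mul (by positivity), ← Real.exp_add, chart_zero]
        simp only [Pi.one_apply, mul_one]
        rw [ENNReal.ofReal_le_one]
        refine Real.exp_le_one_iff.2 ?_
        have := mul_nonneg (Nat.cast_nonneg (α := ℝ) m) (logWidth_nonneg hx)
        linarith
      · have hm : chart x u ∉ {p : Space m | p 0 < 0 ∧ relDistSq p ≤ 2} := fun h =>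
          h2 ((relDistSq_chart x u).symm.trans_le h.2)
        have : weight (chart x u) = 0 := indicator_of_notMem hm _
        simp [hf, indicator, this]
    · rw [hf, indicator_of_notMem (by simpa [chart_zero] using h1)]
      simp
  calc ∫⁻ p in K, weight p ≤ ∫⁻ p, f p := by
        rw [← lintegral_indicator hK.measurableSet]
        refine lintegral_mono (indicator_le_indicator_of_subset (fun p hp => ?_) (by simp))
        have := (PiLp.norm_apply_le p 0).trans (hR p hp)
        exact (abs_le.1 this).1
    _ = _ := lintegral_eq_lintegral_chart hfm fun p hp => by
        simp [hf, weight, indicator, hp.not_gt]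
    _ ≤ ∫⁻ x in Iio (0 : ℝ), (Icc (-R) 0).indicator 1 x * volume D := by
        refine setLIntegral_mono' measurableSet_Iio fun x hx => ?_
        refine (lintegral_mono (hle x hx)).trans ?_
        rw [lintegral_const_mul _ (measurable_one.indicator hDm), lintegral_indicator_one hDm]
    _ ≤ ∫⁻ x, (Icc (-R) 0).indicator 1 x * volume D := setLIntegral_le_lintegral _ _
    _ = volume (Icc (-R) 0) * volume D := by
        rw [lintegral_mul_const _ (measurable_one.indicator measurableSet_Icc),
          lintegral_indicator_one measurableSet_Icc]
    _ < ∞ := ENNReal.mul_lt_top measure_Icc_lt_top hDv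

/-- A function supported in the tube and bounded there by the power `-3/2` of the width is in
`L^{4/3}_loc`. -/
lemma memLp_of_norm_le {F : Type*} [NormedAddCommGroup F] {f : Space m → F}
    (hf : AEStronglyMeasurable f volume) {C : ℝ} (hC : 0 ≤ C)
    (hle : ∀ p, p 0 < 0 → relDistSq p ≤ 2 → ‖f p‖ ≤ C * Real.exp (3 / 2 * logWidth (p 0)))
    (h0 : ∀ p, ¬ (p 0 < 0 ∧ relDistSq p ≤ 2) → f p = 0)
    {K : Set (Space m)} (hK : IsCompact K) :
    MemLp f (ENNReal.ofReal (4 / 3)) (volume.restrict K) := by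
  refine ⟨hf.restrict, ?_⟩
  have hp : ENNReal.ofReal (4 / 3) ≠ 0 := by
    rw [Ne, ENNReal.ofReal_eq_zero]; norm_num
  rw [eLpNorm_lt_top_iff_lintegral_rpow_enorm_lt_top hp ENNReal.ofReal_ne_top,
    ENNReal.toReal_ofReal (by norm_num)]
  have hb : ∀ p, ‖f p‖ₑ ^ (4 / 3 : ℝ) ≤ ENNReal.ofReal (C ^ (4 / 3 : ℝ)) * weight p := by
    intro p
    by_cases hp : p 0 < 0 ∧ relDistSq p ≤ 2
    · have hw : weight p = ENNReal.ofReal (Real.exp (2 * logWidth (p 0))) :=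
        indicator_of_mem (s := {p : Space m | p 0 < 0 ∧ relDistSq p ≤ 2}) hp _
      rw [hw, ← ofReal_norm, ENNReal.ofReal_rpow_of_nonneg (norm_nonneg _) (by norm_num),
        ← ENNReal.ofReal_mul (by positivity)]
      refine ENNReal.ofReal_le_ofReal ?_
      calc ‖f p‖ ^ (4 / 3 : ℝ) ≤ (C * Real.exp (3 / 2 * logWidth (p 0))) ^ (4 / 3 : ℝ) :=
            Real.rpow_le_rpow (norm_nonneg _) (hle p hp.1 hp.2) (by norm_num)
        _ = _ := by
            rw [Real.mul_rpow hC (Real.exp_nonneg _), ← Real.exp_mul]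
            ring_nf
    · rw [h0 p hp]
      simp
  calc _ ≤ ∫⁻ p in K, ENNReal.ofReal (C ^ (4 / 3 : ℝ)) * weight p := lintegral_mono hb
    _ = ENNReal.ofReal (C ^ (4 / 3 : ℝ)) * ∫⁻ p in K, weight p :=
        lintegral_const_mul _ measurable_weight
    _ < ∞ := ENNReal.mul_lt_top ENNReal.ofReal_lt_top (lintegral_weight_lt_top hK)

/-! ### Weak derivatives across the singular hyperplane -/

/-- A smooth cutoff, supported in `{p | p 0 < 0}` for `0 < k`, which tends to the indicator of this
half-space. -/
noncomputable def halfCutoff (k : ℕ) (p : Space m) : ℝ :=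
  Real.smoothTransition (-(k * p 0) - 1)

/-- The partial derivative of `halfCutoff k` in the first coordinate. -/
noncomputable def halfCutoff' (k : ℕ) (p : Space m) : ℝ :=
  -(k * deriv Real.smoothTransition (-(k * p 0) - 1))

lemma hasFDerivAt_halfCutoff (k : ℕ) (p : Space m) :
    HasFDerivAt (halfCutoff k)
      (halfCutoff' k p • (EuclideanSpace.proj 0 : Space m →L[ℝ] ℝ)) p := by
  have h1 : HasDerivAt Real.smoothTransition (deriv Real.smoothTransition (-(k * p 0) - 1))
      (-(k * p 0) - 1) :=
    ((Real.smoothTransition.contDiff (n := 1)).differentiable (by simp) _).hasDerivAt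
  have h2 := (((hasFDerivAt_coord p).const_mul (k : ℝ)).neg).sub_const 1
  refine (h1.comp_hasFDerivAt (f := fun q : Space m => -(k * q 0) - 1) p h2).congr_fderiv ?_
  ext v
  simp [halfCutoff']
  ring

lemma continuous_halfCutoff (k : ℕ) : Continuous (halfCutoff k : Space m → ℝ) := by
  unfold halfCutoff; fun_prop

lemma continuous_halfCutoff' (k : ℕ) : Continuous (halfCutoff' k : Space m → ℝ) := by
  have h : Continuous (deriv Real.smoothTransition) :=
    (Real.smoothTransition.contDiff (n := 1)).continuous_deriv le_rfl
  unfold halfCutoff'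
  fun_prop

lemma abs_halfCutoff_le (k : ℕ) (p : Space m) : |halfCutoff k p| ≤ 1 := by
  rw [halfCutoff, abs_of_nonneg (Real.smoothTransition.nonneg _)]
  exact Real.smoothTransition.le_one _

lemma eventually_halfCutoff {p : Space m} (hp : p 0 < 0) :
    ∀ᶠ k : ℕ in atTop, halfCutoff k p = 1 ∧ halfCutoff' k p = 0 := by
  obtain ⟨N, hN⟩ := exists_nat_gt (2 / (-p 0))
  filter_upwards [eventually_ge_atTop N] with k hk
  have hp' : 0 < -p 0 := by linarith
  have h1 : 2 < (k : ℝ) * (-p 0) := by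
    rw [div_lt_iff₀ hp'] at hN
    exact hN.trans_le (by gcongr)
  constructor
  · exact Real.smoothTransition.one_of_one_le (by linarith)
  · rw [halfCutoff', deriv_smoothTransition_of_one_lt (by linarith), mul_zero, neg_zero]

/-- The derivative of the cutoff is bounded by the inverse of the first coordinate, uniformly. -/
lemma exists_abs_halfCutoff'_le : ∃ L : ℝ, 0 ≤ L ∧ ∀ (k : ℕ) (p : Space m), p 0 < 0 →
    |halfCutoff' k p| ≤ L * |(p 0)⁻¹| := by
  obtain ⟨L, hL0, hL⟩ := exists_abs_deriv_smoothTransition_le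
  refine ⟨2 * L, by positivity, fun k p hp => ?_⟩
  have hp' : 0 < -p 0 := by linarith
  rw [halfCutoff', abs_neg, abs_mul, Nat.abs_cast, abs_inv, abs_of_neg hp]
  rcases le_or_gt (-(k * p 0) - 1) 1 with h | h
  · have h1 : (k : ℝ) ≤ 2 * (-p 0)⁻¹ := by
      rw [← div_eq_mul_inv, le_div_iff₀ hp']
      linarith
    calc _ ≤ 2 * (-p 0)⁻¹ * L := by gcongr; exact hL _
      _ = _ := by ring
  · rw [deriv_smoothTransition_of_one_lt h]
    simp only [abs_zero, mul_zero]
    positivity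

/-- A function which vanishes on `{p | 0 ≤ p 0}` and is differentiable on `{p | p 0 < 0}` has its
pointwise derivative as weak derivative, as soon as its quotient by `p 0` is locally integrable:
there is then no contribution of the hyperplane `{p | p 0 = 0}`. -/
lemma integral_fderiv_smul_eq_neg {F : Type*} [NormedAddCommGroup F] [NormedSpace ℝ F]
    {B : Space m → F} {G : Space m → Space m →L[ℝ] F}
    (hB : LocallyIntegrable B) (hG : LocallyIntegrable G)
    (hB' : LocallyIntegrable fun p => (p 0)⁻¹ • B p)
    (hder : ∀ p, p 0 < 0 → HasFDerivAt B (G p) p)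
    (hB0 : ∀ p, 0 ≤ p 0 → B p = 0) (hG0 : ∀ p, 0 ≤ p 0 → G p = 0)
    {φ : Space m → ℝ} (hφ : ContDiff ℝ (⊤ : ℕ∞) φ) (hc : HasCompactSupport φ) (v : Space m) :
    ∫ x, fderiv ℝ φ x v • B x = - ∫ x, φ x • G x v := by
  have hGv : LocallyIntegrable fun p => G p v := fun p => by
    obtain ⟨s, hs, h⟩ := hG p
    exact ⟨s, hs, (ContinuousLinearMap.apply ℝ F v).integrable_comp h⟩
  have hφd : Differentiable ℝ φ := hφ.differentiable (by simp)
  have hφ' : Continuous fun p => fderiv ℝ φ p v := (hφ.continuous_fderiv (by simp)).clm_apply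
    continuous_const
  have hc' : HasCompactSupport fun p => fderiv ℝ φ p v := hc.fderiv_apply ℝ v
  have hφc := hφ.continuous
  have i1 : ∀ k, Integrable fun p => (halfCutoff k p * φ p) • G p v := fun k =>
    hGv.integrable_smul_left_of_hasCompactSupport ((continuous_halfCutoff k).mul hφc) hc.mul_left
  have i2 : ∀ k, Integrable fun p => (halfCutoff k p * fderiv ℝ φ p v) • B p := fun k =>
    hB.integrable_smul_left_of_hasCompactSupport ((continuous_halfCutoff k).mul hφ') hc'.mul_left
  have i3 : ∀ k, Integrable fun p => (halfCutoff' k p * v 0 * φ p) • B p := fun k =>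
    hB.integrable_smul_left_of_hasCompactSupport
      (((continuous_halfCutoff' k).mul continuous_const).mul hφc) hc.mul_left
  have i4 : ∀ k, Integrable fun p => (halfCutoff k p * φ p) • B p := fun k =>
    hB.integrable_smul_left_of_hasCompactSupport ((continuous_halfCutoff k).mul hφc) hc.mul_left
  -- integration by parts away from the hyperplane
  have key : ∀ k : ℕ, 0 < k → ∫ p, (halfCutoff k p * φ p) • G p v
      = -((∫ p, (halfCutoff k p * fderiv ℝ φ p v) • B p)
        + ∫ p, (halfCutoff' k p * v 0 * φ p) • B p) := by
    intro k hk
    rw [← integral_add (i2 k) (i3 k)]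
    have hfd : ∀ p, HasFDerivAt (fun p => halfCutoff k p * φ p)
        (halfCutoff k p • fderiv ℝ φ p
          + φ p • halfCutoff' k p • (EuclideanSpace.proj 0 : Space m →L[ℝ] ℝ)) p := fun p =>
      (hasFDerivAt_halfCutoff k p).mul (hφd p).hasFDerivAt
    have heq : ∀ p, (halfCutoff k p • fderiv ℝ φ p
          + φ p • halfCutoff' k p • (EuclideanSpace.proj 0 : Space m →L[ℝ] ℝ)) v • B p
        = (halfCutoff k p * fderiv ℝ φ p v) • B p + (halfCutoff' k p * v 0 * φ p) • B p := by
      intro p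
      rw [← add_smul]
      congr 1
      simp
      ring
    have h := integral_bilinear_hasFDerivAt_right_eq_neg_left_of_integrable
      (μ := (volume : Measure (Space m))) (B := ContinuousLinearMap.lsmul ℝ ℝ)
      (f := fun p => halfCutoff k p * φ p) (g := B) (g' := G) (v := v)
      (f' := fun p => halfCutoff k p • fderiv ℝ φ p
          + φ p • halfCutoff' k p • (EuclideanSpace.proj 0 : Space m →L[ℝ] ℝ))
      ((integrable_congr (ae_of_all _ heq)).2 ((i2 k).add (i3 k)))
      (i1 k) (i4 k) (fun p _ => hfd p) (fun p hp => hder p ?_)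
    · simpa only [ContinuousLinearMap.lsmul_apply, heq] using h
    · have hcl : IsClosed {p : Space m | 1 ≤ -(k * p 0)} :=
        isClosed_le continuous_const (by fun_prop)
      have hsub : tsupport (fun p => halfCutoff k p * φ p) ⊆ {p : Space m | 1 ≤ -(k * p 0)} := by
        refine closure_minimal (fun q hq => ?_) hcl
        by_contra hq'
        rw [Set.mem_ofPred_eq] at hq'
        refine hq ?_
        have : halfCutoff k q = 0 :=
          Real.smoothTransition.zero_of_nonpos (by linarith [not_le.1 hq'])
        simp [this]
      have h1 : 1 ≤ -((k : ℝ) * p 0) := hsub hp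
      by_contra h2
      have := mul_nonneg (Nat.cast_nonneg (α := ℝ) k) (not_lt.1 h2)
      linarith
  have t1 : Tendsto (fun k : ℕ => ∫ p, (halfCutoff k p * φ p) • G p v) atTop
      (𝓝 (∫ p, φ p • G p v)) := by
    refine tendsto_integral_of_dominated_convergence (fun p => ‖φ p • G p v‖)
      (fun k => (i1 k).aestronglyMeasurable)
      (hGv.integrable_smul_left_of_hasCompactSupport hφc hc).norm
      (fun k => ae_of_all _ fun p => ?_) (ae_of_all _ fun p => ?_)
    · rw [mul_smul, norm_smul]
      exact mul_le_of_le_one_left (norm_nonneg _) (abs_halfCutoff_le k p)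
    · rcases lt_or_ge (p 0) 0 with hp | hp
      · refine tendsto_const_nhds.congr' ?_
        filter_upwards [eventually_halfCutoff hp] with k hk
        rw [hk.1, one_mul]
      · simp [hG0 p hp]
  have t2 : Tendsto (fun k : ℕ => ∫ p, (halfCutoff k p * fderiv ℝ φ p v) • B p) atTop
      (𝓝 (∫ p, fderiv ℝ φ p v • B p)) := by
    refine tendsto_integral_of_dominated_convergence (fun p => ‖fderiv ℝ φ p v • B p‖)
      (fun k => (i2 k).aestronglyMeasurable)
      (hB.integrable_smul_left_of_hasCompactSupport hφ' hc').norm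
      (fun k => ae_of_all _ fun p => ?_) (ae_of_all _ fun p => ?_)
    · rw [mul_smul, norm_smul]
      exact mul_le_of_le_one_left (norm_nonneg _) (abs_halfCutoff_le k p)
    · rcases lt_or_ge (p 0) 0 with hp | hp
      · refine tendsto_const_nhds.congr' ?_
        filter_upwards [eventually_halfCutoff hp] with k hk
        rw [hk.1, one_mul]
      · simp [hB0 p hp]
  have t3 : Tendsto (fun k : ℕ => ∫ p, (halfCutoff' k p * v 0 * φ p) • B p) atTop
      (𝓝 0) := by
    obtain ⟨L, hL0, hL⟩ := exists_abs_halfCutoff'_le (m := m)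
    rw [← integral_zero (Space m) F]
    refine tendsto_integral_of_dominated_convergence
      (fun p => L * |v 0| * ‖φ p • (p 0)⁻¹ • B p‖)
      (fun k => (i3 k).aestronglyMeasurable)
      ((hB'.integrable_smul_left_of_hasCompactSupport hφc hc).norm.const_mul _)
      (fun k => ae_of_all _ fun p => ?_) (ae_of_all _ fun p => ?_)
    · rcases lt_or_ge (p 0) 0 with hp | hp
      · simp only [norm_smul, norm_mul, Real.norm_eq_abs]
        calc _ ≤ (L * |(p 0)⁻¹|) * |v 0| * |φ p| * ‖B p‖ := by gcongr; exact hL k p hp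
          _ = _ := by ring
      · simp [hB0 p hp]
    · rcases lt_or_ge (p 0) 0 with hp | hp
      · refine tendsto_const_nhds.congr' ?_
        filter_upwards [eventually_halfCutoff hp] with k hk
        simp [hk.2]
      · simp [hB0 p hp]
  have hlim := tendsto_nhds_unique t1 (((t2.add t3).neg).congr' (by
    filter_upwards [eventually_gt_atTop 0] with k hk
    exact (key k hk).symm))
  rw [hlim, add_zero, neg_neg]

/-! ### Sobolev regularity and divergence -/

/-- The weak gradient of `field`. -/
noncomputable def fieldGrad (p : Space m) : Space m →L[ℝ] Space m :=
  if p 0 < 0 then fieldDeriv p else 0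

lemma fieldGrad_of_neg {p : Space m} (hp : p 0 < 0) : fieldGrad p = fieldDeriv p := if_pos hp
lemma fieldGrad_of_nonneg {p : Space m} (hp : 0 ≤ p 0) : fieldGrad p = 0 := if_neg hp.not_gt

lemma stronglyMeasurable_fieldGrad :
    StronglyMeasurable (fieldGrad : Space m → Space m →L[ℝ] Space m) := by
  have h : (fieldGrad : Space m → Space m →L[ℝ] Space m)
      = {p : Space m | p 0 < 0}.indicator (fderiv ℝ field) := by
    funext p
    rcases lt_or_ge (p 0) 0 with hp | hp
    · rw [fieldGrad_of_neg hp, indicator_of_mem (by exact hp), (hasFDerivAt_field hp).fderiv]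
    · rw [fieldGrad_of_nonneg hp, indicator_of_notMem (by exact hp.not_gt)]
  rw [h]
  exact ((measurable_fderiv ℝ field).indicator
    (measurableSet_lt (measurable_coord 0) measurable_const)).stronglyMeasurable

/-- Powers of the inverse of the first coordinate are absorbed by half a power of the width. -/
lemma exists_le_exp_logWidth (k : ℕ) {c : ℝ} (hc : 0 ≤ c) :
    ∃ C : ℝ, 0 ≤ C ∧ ∀ x < 0, ∀ s ≤ 1, c * (1 + |x⁻¹|) ^ k * Real.exp (s * logWidth x)
      ≤ C * Real.exp (3 / 2 * logWidth x) := by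
  obtain ⟨M, hM0, hM⟩ := exists_pow_le_exp_logWidth k
  refine ⟨c * M, by positivity, fun x hx s hs => ?_⟩
  have hA := logWidth_nonneg hx
  calc _ ≤ c * (M * Real.exp (logWidth x / 2)) * Real.exp (1 * logWidth x) := by
        gcongr
        exact hM x hx
    _ = c * M * (Real.exp (logWidth x / 2) * Real.exp (1 * logWidth x)) := by ring
    _ = _ := by rw [← Real.exp_add]; ring_nf

lemma memLp_field {K : Set (Space m)} (hK : IsCompact K) :
    MemLp field (ENNReal.ofReal (4 / 3)) (volume.restrict K) := by
  obtain ⟨C, hC0, hC⟩ := exists_le_exp_logWidth 3 (by norm_num : (0 : ℝ) ≤ 4)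
  refine memLp_of_norm_le measurable_field.aestronglyMeasurable hC0 (fun p hp h => ?_)
    (fun p hp => ?_) hK
  · refine (norm_field_le hp h).trans ?_
    simpa using hC (p 0) hp 0 zero_le_one
  · rcases lt_or_ge (p 0) 0 with h | h
    · exact field_eq_zero (not_le.1 fun h' => hp ⟨h, h'⟩).le
    · exact field_of_nonneg h

lemma memLp_inv_smul_field {K : Set (Space m)} (hK : IsCompact K) :
    MemLp (fun p : Space m => (p 0)⁻¹ • field p) (ENNReal.ofReal (4 / 3))
      (volume.restrict K) := by
  obtain ⟨C, hC0, hC⟩ := exists_le_exp_logWidth 4 (by norm_num : (0 : ℝ) ≤ 4)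
  refine memLp_of_norm_le (f := fun p : Space m => (p 0)⁻¹ • field p)
    ((measurable_coord 0).inv.smul measurable_field).aestronglyMeasurable hC0
    (fun p hp h => ?_) (fun p hp => ?_) hK
  · have h1 := norm_field_le hp h
    refine le_trans ?_ ((hC (p 0) hp 0 zero_le_one))
    rw [norm_smul, Real.norm_eq_abs, zero_mul, Real.exp_zero, mul_one]
    have h0 := abs_nonneg (p 0)⁻¹
    calc _ ≤ (1 + |(p 0)⁻¹|) * (4 * (1 + |(p 0)⁻¹|) ^ 3) := by gcongr; linarith
      _ = _ := by ring
  · rcases lt_or_ge (p 0) 0 with h | h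
    · rw [field_eq_zero (not_le.1 fun h' => hp ⟨h, h'⟩).le, smul_zero]
    · rw [field_of_nonneg h, smul_zero]

lemma memLp_fieldGrad {K : Set (Space m)} (hK : IsCompact K) :
    MemLp fieldGrad (ENNReal.ofReal (4 / 3)) (volume.restrict K) := by
  obtain ⟨L, hL0, hL⟩ := exists_norm_fieldDeriv_le (m := m)
  obtain ⟨C, hC0, hC⟩ := exists_le_exp_logWidth 6 hL0
  refine memLp_of_norm_le stronglyMeasurable_fieldGrad.aestronglyMeasurable
    hC0 (fun p hp h => ?_) (fun p hp => ?_) hK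
  · rw [fieldGrad_of_neg hp]
    refine (hL p hp h).trans ?_
    simpa using hC (p 0) hp 1 le_rfl
  · rcases lt_or_ge (p 0) 0 with h | h
    · rw [fieldGrad_of_neg h, fieldDeriv_eq_zero (not_le.1 fun h' => hp ⟨h, h'⟩)]
    · exact fieldGrad_of_nonneg h

lemma locallyIntegrable_of_memLp {F : Type*} [NormedAddCommGroup F] {f : Space m → F} {q : ℝ≥0∞}
    (hq : 1 ≤ q) (hf : ∀ K : Set (Space m), IsCompact K → MemLp f q (volume.restrict K)) :
    LocallyIntegrable f := fun p => by
  have hK := isCompact_closedBall p 1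
  have : IsFiniteMeasure (volume.restrict (Metric.closedBall p 1)) :=
    ⟨by simpa using hK.measure_lt_top⟩
  exact ⟨_, Metric.closedBall_mem_nhds p one_pos, (hf _ hK).integrable hq⟩

lemma one_le_exponent : (1 : ℝ≥0∞) ≤ ENNReal.ofReal (4 / 3) := by
  rw [ENNReal.one_le_ofReal]; norm_num

lemma locallyIntegrable_field : LocallyIntegrable (field : Space m → Space m) :=
  locallyIntegrable_of_memLp one_le_exponent fun _ => memLp_field

lemma locallyIntegrable_fieldGrad :
    LocallyIntegrable (fieldGrad : Space m → Space m →L[ℝ] Space m) :=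
  locallyIntegrable_of_memLp one_le_exponent fun _ => memLp_fieldGrad

lemma integral_fderiv_smul_field {φ : Space m → ℝ} (hφ : ContDiff ℝ (⊤ : ℕ∞) φ)
    (hc : HasCompactSupport φ) (v : Space m) :
    ∫ x, fderiv ℝ φ x v • field x = - ∫ x, φ x • fieldGrad x v :=
  integral_fderiv_smul_eq_neg locallyIntegrable_field locallyIntegrable_fieldGrad
    (locallyIntegrable_of_memLp one_le_exponent fun _ => memLp_inv_smul_field)
    (fun p hp => by rw [fieldGrad_of_neg hp]; exact hasFDerivAt_field hp)
    (fun _ => field_of_nonneg) (fun _ => fieldGrad_of_nonneg) hφ hc v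

lemma memSobolevLoc_field :
    MemSobolevLoc (ENNReal.ofReal (4 / 3)) (field : Space m → Space m) :=
  ⟨fun _ => memLp_field, fieldGrad, fun _ => memLp_fieldGrad,
    fun _ hφ hc v => integral_fderiv_smul_field hφ hc v⟩

/-- The divergence of `field`. -/
noncomputable def fieldDiv (p : Space m) : ℝ := -((m + 2) * height (p 0) ^ 2 * speed p)

lemma trace_fieldGrad (p : Space m) :
    ∑ i, fieldGrad p (EuclideanSpace.single i 1) i = fieldDiv p := by
  rcases lt_or_ge (p 0) 0 with hp | hp
  · rw [fieldGrad_of_neg hp, trace_fieldDeriv hp, fieldDiv]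
  · simp [fieldGrad_of_nonneg hp, fieldDiv, speed_of_nonneg hp]

lemma abs_fieldDiv_le (p : Space m) : |fieldDiv p| ≤ (m + 2) * (‖p‖ + 2) ^ 2 := by
  rw [fieldDiv, abs_neg, abs_of_nonneg (by have := speed_nonneg p; positivity)]
  by_cases h : speed p = 0
  · rw [h, mul_zero]; positivity
  · have h1 := abs_height_le_norm (neg_of_speed_ne_zero h) (relDistSq_lt_two h).le
    have h2 : height (p 0) ^ 2 ≤ (‖p‖ + 2) ^ 2 := by rw [← sq_abs]; gcongr
    calc _ ≤ (m + 2) * (‖p‖ + 2) ^ 2 * 1 := by gcongr; exacts [speed_nonneg p, speed_le_one p]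
      _ = _ := mul_one _

lemma hasLocallyBoundedDiv_field : HasLocallyBoundedDiv (field : Space m → Space m) := by
  refine ⟨fieldDiv, fun K hK => ?_, fun φ hφ hc => ?_⟩
  · obtain ⟨R, hR⟩ := hK.isBounded.exists_norm_le
    have hm : Measurable (fieldDiv : Space m → ℝ) :=
      ((((measurable_height.comp (measurable_coord 0)).pow_const 2).const_mul _).mul
        measurable_speed).neg
    refine memLp_top_of_bound hm.aestronglyMeasurable ((m + 2) * (R + 2) ^ 2) ?_
    filter_upwards [ae_restrict_mem hK.measurableSet] with p hp
    refine (abs_fieldDiv_le p).trans ?_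
    have := hR p hp
    gcongr
  · have h1 : ∀ p : Space m, fderiv ℝ φ p (field p)
        = ∑ i, fderiv ℝ φ p (EuclideanSpace.single i 1) * field p i := by
      intro p
      conv_lhs => rw [← (EuclideanSpace.basisFun (Fin (m + 3)) ℝ).sum_repr (field p), map_sum]
      simp [mul_comm]
    have hcomp : ∀ i : Fin (m + 3), Integrable fun p =>
        fderiv ℝ φ p (EuclideanSpace.single i 1) • field p := fun i =>
      locallyIntegrable_field.integrable_smul_left_of_hasCompactSupport
        ((hφ.continuous_fderiv (by simp)).clm_apply continuous_const) (hc.fderiv_apply ℝ _)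
    have hcomp' : ∀ i : Fin (m + 3), Integrable fun p =>
        φ p • fieldGrad p (EuclideanSpace.single i 1) := fun i => by
      refine LocallyIntegrable.integrable_smul_left_of_hasCompactSupport (fun p => ?_)
        hφ.continuous hc
      obtain ⟨s, hs, h⟩ := locallyIntegrable_fieldGrad (m := m) p
      exact ⟨s, hs, (ContinuousLinearMap.apply ℝ (Space m)
        (EuclideanSpace.single i 1 : Space m)).integrable_comp h⟩
    have h2 : ∀ i : Fin (m + 3), ∫ p, fderiv ℝ φ p (EuclideanSpace.single i 1) * field p i
        = -∫ p, φ p * fieldGrad p (EuclideanSpace.single i 1) i := by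
      intro i
      have h3 := congrArg (EuclideanSpace.proj i : Space m →L[ℝ] ℝ)
        (integral_fderiv_smul_field hφ hc (EuclideanSpace.single i 1))
      rw [map_neg, ← ContinuousLinearMap.integral_comp_comm _ (hcomp i),
        ← ContinuousLinearMap.integral_comp_comm _ (hcomp' i)] at h3
      simpa using h3
    simp_rw [h1, ← trace_fieldGrad, Finset.mul_sum]
    rw [integral_finsetSum _ fun i _ => ?_, integral_finsetSum _ fun i _ => ?_,
      ← Finset.sum_neg_distrib]
    · exact Finset.sum_congr rfl fun i _ => h2 i
    · simpa using (EuclideanSpace.proj i : Space m →L[ℝ] ℝ).integrable_comp (hcomp' i)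
    · simpa using (EuclideanSpace.proj i : Space m →L[ℝ] ℝ).integrable_comp (hcomp i)

/-! ### The flow -/

/-- The flow of `field`: the first coordinate moves with constant speed, and the position in the
cross section of the tube, measured in units of its width, is constant. -/
noncomputable def flow (t : ℝ) (p : Space m) : Space m :=
  if p 0 < 0 then
    axis (p 0 + speed p * t) +
      Real.exp (logWidth (p 0) - logWidth (p 0 + speed p * t)) • offset p
  else p

/-- The existence time of the trajectories of `flow`, up to the time horizon `T`. -/
noncomputable def lifetime (T : ℝ) (p : Space m) : ℝ :=
  if speed p = 0 then T else min T (-p 0 / speed p)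

lemma flow_of_neg {p : Space m} (hp : p 0 < 0) (t : ℝ) : flow t p =
    axis (p 0 + speed p * t) +
      Real.exp (logWidth (p 0) - logWidth (p 0 + speed p * t)) • offset p := if_pos hp
lemma flow_of_nonneg {p : Space m} (hp : 0 ≤ p 0) (t : ℝ) : flow t p = p := if_neg hp.not_gt

lemma flow_zero (p : Space m) : flow 0 p = p := by
  rcases lt_or_ge (p 0) 0 with hp | hp
  · simp [flow_of_neg hp, offset]
  · exact flow_of_nonneg hp 0

lemma flow_coord_zero {p : Space m} (hp : p 0 < 0) (t : ℝ) :
    flow t p 0 = p 0 + speed p * t := by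
  simp [flow_of_neg hp, axis_zero, offset_zero]

lemma offset_flow {p : Space m} (hp : p 0 < 0) (t : ℝ) : offset (flow t p) =
    Real.exp (logWidth (p 0) - logWidth (p 0 + speed p * t)) • offset p := by
  rw [offset, flow_coord_zero hp, flow_of_neg hp, add_sub_cancel_left]

lemma relDistSq_flow {p : Space m} (hp : p 0 < 0) (t : ℝ) :
    relDistSq (flow t p) = relDistSq p := by
  rw [relDistSq, offset_flow hp, flow_coord_zero hp, norm_smul, mul_pow, ← mul_assoc,
    Real.norm_of_nonneg (Real.exp_nonneg _), ← Real.exp_nat_mul, ← Real.exp_add, relDistSq]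
  congr 2
  push_cast
  ring

lemma speed_flow {p : Space m} (hp : p 0 < 0) {t : ℝ} (ht : p 0 + speed p * t < 0) :
    speed (flow t p) = speed p := by
  rw [speed_of_neg (by rwa [flow_coord_zero hp]), relDistSq_flow hp, speed_of_neg hp]

/-- In the coordinates of the tube, the flow is a translation in the first variable. -/
lemma flow_chart {x : ℝ} (hx : x < 0) (u : Fin (m + 2) → ℝ) (t : ℝ) :
    flow t (chart x u) = chart (x + cutoff (‖crossSection u‖ ^ 2) * t) u := by
  have h0 : chart x u 0 < 0 := by rwa [chart_zero]
  rw [flow_of_neg h0, speed_of_neg h0, relDistSq_chart, chart_zero, offset_chart, smul_smul,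
    ← Real.exp_add, chart]
  congr 3
  ring

lemma measurable_flow_uncurry : Measurable fun q : ℝ × Space m => flow q.1 q.2 := by
  have h0 : Measurable fun q : ℝ × Space m => q.2 0 := (measurable_coord 0).comp measurable_snd
  have h1 : Measurable fun q : ℝ × Space m => q.2 0 + speed q.2 * q.1 :=
    h0.add ((measurable_speed.comp measurable_snd).mul measurable_fst)
  exact Measurable.ite (measurableSet_lt h0 measurable_const)
    ((measurable_axis.comp h1).add (((measurable_logWidth.comp h0).sub
      (measurable_logWidth.comp h1)).exp.smul (measurable_offset.comp measurable_snd)))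
    measurable_snd

lemma measurable_flow (t : ℝ) : Measurable (flow t : Space m → Space m) :=
  measurable_flow_uncurry.comp measurable_prodMk_left

lemma measurable_lifetime (T : ℝ) : Measurable (lifetime T : Space m → ℝ) :=
  Measurable.ite (measurable_speed (measurableSet_singleton 0)) measurable_const
    (measurable_const.min ((measurable_coord 0).neg.div measurable_speed))

lemma lifetime_le (T : ℝ) (p : Space m) : lifetime T p ≤ T := by
  unfold lifetime; split_ifs
  exacts [le_rfl, min_le_left _ _]

lemma speed_pos {p : Space m} (h : speed p ≠ 0) : 0 < speed p :=
  lt_of_le_of_ne (speed_nonneg p) (Ne.symm h)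

lemma lifetime_pos {T : ℝ} (hT : 0 < T) (p : Space m) : 0 < lifetime T p := by
  unfold lifetime; split_ifs with h
  · exact hT
  · exact lt_min hT (div_pos (neg_pos.2 (neg_of_speed_ne_zero h)) (speed_pos h))

lemma coord_neg_of_lt_lifetime {T t : ℝ} {p : Space m} (hp : p 0 < 0) (ht : t < lifetime T p) :
    p 0 + speed p * t < 0 := by
  unfold lifetime at ht
  split_ifs at ht with h
  · simpa [h] using hp
  · have := (lt_min_iff.1 ht).2
    rw [lt_div_iff₀ (speed_pos h)] at this
    linarith

lemma field_flow {p : Space m} (hp : p 0 < 0) {t : ℝ} (ht : p 0 + speed p * t < 0) :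
    field (flow t p) = speed p • (axis' (p 0 + speed p * t) - height (p 0 + speed p * t) ^ 2 •
      Real.exp (logWidth (p 0) - logWidth (p 0 + speed p * t)) • offset p) := by
  rw [field, speed_flow hp ht, drift, offset_flow hp, flow_coord_zero hp]

lemma hasDerivAt_flow {p : Space m} {t : ℝ} (ht : p 0 < 0 → p 0 + speed p * t < 0) :
    HasDerivAt (fun s => flow s p) (field (flow t p)) t := by
  rcases lt_or_ge (p 0) 0 with hp | hp
  · have hx := (ht hp).ne
    have h0 : HasDerivAt (fun s : ℝ => p 0 + speed p * s) (speed p) t := by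
      simpa using ((hasDerivAt_id t).const_mul (speed p)).const_add (p 0)
    have h1 := (hasDerivAt_axis (m := m) hx).scomp t h0
    have h2 := ((((hasDerivAt_logWidth hx).comp t h0).const_sub (logWidth (p 0))).exp).smul_const
      (offset p)
    rw [field_flow hp (ht hp)]
    simp_rw [flow_of_neg hp]
    refine (h1.add h2).congr_deriv ?_
    simp only [Function.comp_apply]
    module
  · simp_rw [flow_of_nonneg hp, field_of_nonneg hp]
    exact hasDerivAt_const t p

lemma contDiffAt_flow {p : Space m} {t : ℝ} (ht : p 0 < 0 → p 0 + speed p * t < 0)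
    {n : WithTop ℕ∞} : ContDiffAt ℝ n (fun s => flow s p) t := by
  rcases lt_or_ge (p 0) 0 with hp | hp
  · have hx := (ht hp).ne
    have h0 : ContDiffAt ℝ n (fun s : ℝ => p 0 + speed p * s) t := by fun_prop
    simp_rw [flow_of_neg hp]
    exact (ContDiffAt.comp (g := axis) t (contDiffAt_axis hx) h0).add
      ((contDiffAt_const.sub
        (ContDiffAt.comp (g := logWidth) t (contDiffAt_logWidth hx) h0)).exp.smul contDiffAt_const)
  · simp_rw [flow_of_nonneg hp]
    exact contDiffAt_const

lemma absolutelyContinuousOnInterval_flow {T t : ℝ} {p : Space m} (h0 : 0 ≤ t)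
    (ht : t < lifetime T p) : AbsolutelyContinuousOnInterval (fun s => flow s p) 0 t := by
  refine ContDiffOn.absolutelyContinuousOnInterval fun s hs => ?_
  rw [uIcc_of_le h0] at hs
  exact (contDiffAt_flow fun hp =>
    coord_neg_of_lt_lifetime hp (hs.2.trans_lt ht)).contDiffWithinAt

/-! ### Compression of the flow -/

/-- Before its hitting time in `U`, a curve lives and stays in `U`. -/
lemma mem_of_lt_hittingTime {d : ℕ} {U : Set (EuclideanSpace ℝ (Fin d))} {τ t : ℝ}
    {η : ℝ → EuclideanSpace ℝ (Fin d)} (h0 : 0 ≤ t) (ht : t < hittingTime U τ η) :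
    t < τ ∧ ∀ s ∈ Icc 0 t, η s ∈ U := by
  unfold hittingTime at ht
  have hne : {t : ℝ | 0 ≤ t ∧ t < τ ∧
      (⨆ s ∈ Icc 0 t, confiningPotential U (η s)) < ∞}.Nonempty := by
    by_contra h
    rw [not_nonempty_iff_eq_empty] at h
    rw [h, Real.sSup_empty] at ht
    exact ht.not_ge h0
  obtain ⟨r, ⟨-, hr, hsup⟩, htr⟩ := exists_lt_of_lt_csSup hne ht
  refine ⟨htr.trans hr, fun s hs => ?_⟩
  by_contra hU
  have h1 : confiningPotential U (η s) = ∞ := by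
    unfold confiningPotential
    rw [Metric.infEDist_zero_of_mem (show η s ∈ Uᶜ from hU)]
    simp
  have h2 : confiningPotential U (η s) ≤ ⨆ s ∈ Icc 0 r, confiningPotential U (η s) :=
    le_iSup₂_of_le s ⟨hs.1, hs.2.trans htr.le⟩ le_rfl
  rw [h1] at h2
  exact (h2.trans_lt hsup).ne rfl

/-- The width of the tube shrinks by a bounded factor along trajectories in a bounded set. -/
lemma logWidth_sub_le {p : Space m} {t R : ℝ} (hp : p 0 < 0) (h0 : 0 ≤ t)
    (ht : p 0 + speed p * t < 0) (hR : ∀ s ∈ Icc 0 t, ‖flow s p‖ ≤ R) :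
    logWidth (p 0 + speed p * t) - logWidth (p 0) ≤ (R + 2) ^ 2 * t := by
  have hneg : ∀ s ∈ Icc 0 t, p 0 + speed p * s < 0 := fun s hs => by
    have := mul_le_mul_of_nonneg_left hs.2 (speed_nonneg p)
    linarith
  have hd : ∀ s ∈ Icc 0 t, HasDerivAt (fun s => logWidth (p 0 + speed p * s))
      (height (p 0 + speed p * s) ^ 2 * speed p) s := fun s hs => by
    have h1 : HasDerivAt (fun s : ℝ => p 0 + speed p * s) (speed p) s := by
      simpa using ((hasDerivAt_id s).const_mul (speed p)).const_add (p 0)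
    exact HasDerivAt.comp (h₂ := logWidth) s (hasDerivAt_logWidth (hneg s hs).ne) h1
  have h := (convex_Icc 0 t).image_sub_le_mul_sub_of_deriv_le
    (fun s hs => (hd s hs).continuousAt.continuousWithinAt)
    (fun s hs => (hd s (interior_subset hs)).differentiableAt.differentiableWithinAt)
    (C := (R + 2) ^ 2) (fun s hs => ?_) 0 ⟨le_rfl, h0⟩ t ⟨h0, le_rfl⟩ h0
  · simpa using h
  · have hs' := interior_subset hs
    rw [(hd s hs').deriv]
    by_cases hz : speed p = 0
    · rw [hz, mul_zero]; positivity
    · have h1 := abs_height_le_norm (p := flow s p)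
        (by rw [flow_coord_zero hp]; exact hneg s hs')
        (by rw [relDistSq_flow hp]; exact (relDistSq_lt_two hz).le)
      rw [flow_coord_zero hp] at h1
      have h2 : height (p 0 + speed p * s) ^ 2 ≤ (R + 2) ^ 2 := by
        rw [← sq_abs]
        have := hR s hs'
        gcongr
        linarith
      calc _ ≤ height (p 0 + speed p * s) ^ 2 * 1 := by gcongr; exact speed_le_one p
        _ ≤ _ := by rwa [mul_one]

/-- The flow up to time `t` compresses Lebesgue measure by a bounded factor on the set of points
along whose trajectories the width of the tube has shrunk by a bounded factor. -/
lemma volume_flow_preimage_le {c t : ℝ} {B : Set (Space m)} (hB : MeasurableSet B) :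
    volume {p : Space m | p 0 < 0 ∧ p 0 + speed p * t < 0 ∧
        logWidth (p 0 + speed p * t) - logWidth (p 0) ≤ c ∧ flow t p ∈ B}
      ≤ ENNReal.ofReal (Real.exp ((m + 2) * c)) * volume (B ∩ {p | p 0 < 0}) := by
  set E := {p : Space m | p 0 < 0 ∧ p 0 + speed p * t < 0 ∧
        logWidth (p 0 + speed p * t) - logWidth (p 0) ≤ c ∧ flow t p ∈ B} with hE
  set B' : Set (Space m) := B ∩ {p | p 0 < 0} with hB'
  have hneg : MeasurableSet {p : Space m | p 0 < 0} :=
    measurableSet_lt (measurable_coord 0) measurable_const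
  have hB'm : MeasurableSet B' := hB.inter hneg
  have hxt : Measurable fun p : Space m => p 0 + speed p * t :=
    (measurable_coord 0).add (measurable_speed.mul_const t)
  have hEm : MeasurableSet E :=
    hneg.inter ((measurableSet_lt hxt measurable_const).inter
      ((measurableSet_le ((measurable_logWidth.comp hxt).sub
        (measurable_logWidth.comp (measurable_coord 0))) measurable_const).inter
        (measurable_flow t hB)))
  -- the density of Lebesgue measure on `B'` in the coordinates of the tube
  set G : ℝ × (Fin (m + 2) → ℝ) → ℝ≥0∞ := fun q =>
    ENNReal.ofReal (Real.exp (-((m + 2) * logWidth q.1))) * B'.indicator 1 (chart q.1 q.2) with hG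
  have hGm : Measurable G :=
    (ENNReal.measurable_ofReal.comp
      (((measurable_logWidth.comp measurable_fst).const_mul _).neg.exp)).mul
      ((measurable_one.indicator hB'm).comp measurable_chart)
  set h : (Fin (m + 2) → ℝ) → ℝ := fun u => cutoff (‖crossSection u‖ ^ 2) with hh
  have hhm : Measurable h :=
    measurable_cutoff.comp (continuous_crossSection.norm.pow 2).measurable
  have hle : ∀ x < 0, ∀ u : Fin (m + 2) → ℝ,
      ENNReal.ofReal (Real.exp (-((m + 2) * logWidth x))) * E.indicator 1 (chart x u)
        ≤ ENNReal.ofReal (Real.exp ((m + 2) * c)) * G (x + h u * t, u) := by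
    intro x hx u
    by_cases hq : chart x u ∈ E
    · have hq' := hq
      rw [hE] at hq'
      obtain ⟨h1, h2, h3, h4⟩ := hq'
      rw [speed_of_neg h1, relDistSq_chart, chart_zero] at h2 h3
      rw [flow_chart hx] at h4
      have h5 : chart (x + h u * t) u ∈ B' := ⟨h4, by rw [Set.mem_ofPred_eq, chart_zero]; exact h2⟩
      simp only [hG]
      rw [indicator_of_mem hq, indicator_of_mem h5]
      simp only [Pi.one_apply, mul_one]
      rw [← ENNReal.ofReal_mul (by positivity), ← Real.exp_add]
      refine ENNReal.ofReal_le_ofReal (Real.exp_le_exp.2 ?_)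
      have : 0 ≤ (m + 2 : ℝ) * (c - (logWidth (x + h u * t) - logWidth x)) :=
        mul_nonneg (by positivity) (by linarith)
      linarith
    · rw [indicator_of_notMem hq]
      simp
  have hvol : ∀ s : Set (Space m), MeasurableSet s → (∀ p ∈ s, p 0 < 0) → volume s
      = ∫⁻ x in Iio (0 : ℝ), ∫⁻ u : Fin (m + 2) → ℝ,
        ENNReal.ofReal (Real.exp (-((m + 2) * logWidth x))) * s.indicator 1 (chart x u) := by
    intro s hs hs0
    rw [← lintegral_indicator_one hs]
    exact lintegral_eq_lintegral_chart (measurable_one.indicator hs) fun p hp =>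
      indicator_of_notMem (fun h' => (hs0 p h').not_ge hp) _
  have hshift : Measurable fun q : ℝ × (Fin (m + 2) → ℝ) => G (q.1 + h q.2 * t, q.2) :=
    hGm.comp ((measurable_fst.add ((hhm.comp measurable_snd).mul_const t)).prodMk measurable_snd)
  calc volume E
      = ∫⁻ x in Iio (0 : ℝ), ∫⁻ u : Fin (m + 2) → ℝ,
        ENNReal.ofReal (Real.exp (-((m + 2) * logWidth x))) * E.indicator 1 (chart x u) :=
        hvol E hEm fun p hp => hp.1
    _ ≤ ∫⁻ x in Iio (0 : ℝ), ∫⁻ u : Fin (m + 2) → ℝ,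
        ENNReal.ofReal (Real.exp ((m + 2) * c)) * G (x + h u * t, u) :=
        setLIntegral_mono' measurableSet_Iio fun x hx => lintegral_mono (hle x hx)
    _ ≤ ∫⁻ x, ∫⁻ u, ENNReal.ofReal (Real.exp ((m + 2) * c)) * G (x + h u * t, u) :=
        setLIntegral_le_lintegral _ _
    _ = ∫⁻ u, ∫⁻ x, ENNReal.ofReal (Real.exp ((m + 2) * c)) * G (x + h u * t, u) :=
        lintegral_lintegral_swap (hshift.const_mul _).aemeasurable
    _ = ∫⁻ u, ∫⁻ x, ENNReal.ofReal (Real.exp ((m + 2) * c)) * G (x, u) :=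
        lintegral_congr fun u =>
          lintegral_add_right_eq_self (fun x => ENNReal.ofReal (Real.exp ((m + 2) * c)) * G (x, u))
            (h u * t)
    _ = ∫⁻ x, ∫⁻ u, ENNReal.ofReal (Real.exp ((m + 2) * c)) * G (x, u) :=
        (lintegral_lintegral_swap (f := fun x u => ENNReal.ofReal (Real.exp ((m + 2) * c))
          * G (x, u)) (hGm.const_mul _).aemeasurable).symm
    _ = ENNReal.ofReal (Real.exp ((m + 2) * c)) * ∫⁻ x, ∫⁻ u, G (x, u) := by
        rw [← lintegral_const_mul _ hGm.lintegral_prod_right']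
        exact lintegral_congr fun x => lintegral_const_mul _ (hGm.comp measurable_prodMk_left)
    _ = ENNReal.ofReal (Real.exp ((m + 2) * c)) * volume B' := by
        rw [hvol B' hB'm fun p hp => hp.2, ← lintegral_indicator measurableSet_Iio]
        congr 1
        refine lintegral_congr fun x => ?_
        by_cases hx : x < 0
        · rw [indicator_of_mem (mem_Iio.2 hx)]
        · rw [indicator_of_notMem (by simpa using hx)]
          have : ∀ u : Fin (m + 2) → ℝ, chart x u ∉ B' := fun u hu =>
            hx (by simpa only [Set.mem_ofPred_eq, chart_zero] using hu.2)
          simp [hG, indicator_of_notMem (this _)]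

/-- Local bounded compression of the flow. -/
lemma flow_compression (T : ℝ) {U : Set (Space m)} (hU : IsOpen U)
    (hb : Bornology.IsBounded U) : ∃ C : ℝ≥0, ∀ t ∈ Icc 0 T,
      (volume.restrict {p | t < hittingTime U (lifetime T p) fun s => flow s p}).map (flow t)
        ≤ C • volume.restrict U := by
  obtain ⟨R, hR⟩ := hb.exists_norm_le
  set c := (R + 2) ^ 2 * T with hc
  set C : ℝ≥0 := max 1 (Real.toNNReal (Real.exp ((m + 2) * c))) with hC
  refine ⟨C, fun t ht => Measure.le_iff.2 fun s hs => ?_⟩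
  have hsU := hs.inter hU.measurableSet
  rw [Measure.map_apply (measurable_flow t) hs, Measure.restrict_apply (measurable_flow t hs),
    Measure.smul_apply, Measure.restrict_apply hs]
  have hsub : flow t ⁻¹' s ∩ {p | t < hittingTime U (lifetime T p) fun s => flow s p}
      ⊆ {p : Space m | p 0 < 0 ∧ p 0 + speed p * t < 0 ∧
        logWidth (p 0 + speed p * t) - logWidth (p 0) ≤ c ∧ flow t p ∈ s ∩ U}
        ∪ (s ∩ U ∩ {p | p 0 < 0}ᶜ) := by
    rintro p ⟨hps, hpt⟩
    obtain ⟨h1, h2⟩ := mem_of_lt_hittingTime ht.1 hpt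
    rcases lt_or_ge (p 0) 0 with hp | hp
    · have h3 := coord_neg_of_lt_lifetime hp h1
      refine Or.inl ⟨hp, h3, ?_, hps, h2 t ⟨ht.1, le_rfl⟩⟩
      refine (logWidth_sub_le hp ht.1 h3 fun s hs => hR _ (h2 s hs)).trans ?_
      exact mul_le_mul_of_nonneg_left ht.2 (sq_nonneg _)
    · refine Or.inr ⟨⟨?_, ?_⟩, hp.not_gt⟩
      · rw [mem_preimage, flow_of_nonneg hp] at hps; exact hps
      · have := h2 t ⟨ht.1, le_rfl⟩
        rwa [flow_of_nonneg hp] at this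
  have hC1 : (1 : ℝ≥0∞) ≤ C := by exact_mod_cast le_max_left _ _
  have hC2 : ENNReal.ofReal (Real.exp ((m + 2) * c)) ≤ C := by
    exact ENNReal.coe_le_coe.2 (le_max_right _ _)
  calc _ ≤ _ := measure_mono hsub
    _ ≤ _ := measure_union_le _ _
    _ ≤ C * volume (s ∩ U ∩ {p | p 0 < 0}) + C * volume (s ∩ U ∩ {p | p 0 < 0}ᶜ) := by
        refine add_le_add ((volume_flow_preimage_le hsU).trans (by gcongr)) ?_
        exact le_mul_of_one_le_left zero_le hC1
    _ = C * volume (s ∩ U) := by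
        rw [← mul_add, ← sdiff_eq, measure_inter_add_sdiff _
          (measurableSet_lt (measurable_coord 0) measurable_const)]
    _ = _ := by rw [ENNReal.smul_def, smul_eq_mul]

/-! ### Behaviour at the end of the lifetime -/

/-- As `t` increases to `-p 0 / speed p`, the first coordinate increases to `0`; every sequence
`x k < 0` which tends to `0` is attained along the trajectory. -/
lemma tendsto_time {p : Space m} (hs : speed p ≠ 0) {x : ℕ → ℝ} (hx : ∀ᶠ k in atTop, x k < 0)
    (hx0 : Tendsto x atTop (𝓝 0)) :
    Tendsto (fun k => (x k - p 0) / speed p) atTop (𝓝[<] (-p 0 / speed p)) := by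
  refine tendsto_nhdsWithin_of_tendsto_nhds_of_eventually_within _ ?_ ?_
  · simpa using (hx0.sub_const (p 0)).div_const (speed p)
  · filter_upwards [hx] with k hk
    exact div_lt_div_of_pos_right (by linarith) (speed_pos hs)

lemma flow_time {p : Space m} (hs : speed p ≠ 0) (x : ℝ) : flow ((x - p 0) / speed p) p =
    axis x + Real.exp (logWidth (p 0) - logWidth x) • offset p := by
  rw [flow_of_neg (neg_of_speed_ne_zero hs), mul_div_cancel₀ _ hs, add_sub_cancel]

/-- The displacement from the axis tends to `0`. -/
lemma tendsto_offset {p : Space m} {x : ℕ → ℝ} (hx : ∀ᶠ k in atTop, x k < 0)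
    (hx0 : Tendsto (fun k => |(x k)⁻¹|) atTop atTop) :
    Tendsto (fun k => Real.exp (logWidth (p 0) - logWidth (x k)) • offset p) atTop (𝓝 0) := by
  rw [← zero_smul ℝ (offset p)]
  refine Tendsto.smul_const (Real.tendsto_exp_atBot.comp ?_) _
  refine tendsto_atBot_mono' _ (f₂ := fun k => logWidth (p 0) - logWidth (x k))
    (f₁ := fun k => (logWidth (p 0) + 1 / 4) + -(|(x k)⁻¹| / 2)) ?_ ?_
  · filter_upwards [hx] with k hk
    linarith [logWidth_lower hk]
  · exact tendsto_atBot_add_const_left _ _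
      (tendsto_neg_atTop_atBot.comp (hx0.atTop_div_const two_pos))

lemma limsup_flow {p : Space m} (hs : speed p ≠ 0) :
    limsup (fun t => ‖flow t p‖ₑ) (𝓝[<] (-p 0 / speed p)) = ∞ := by
  -- at these points `sin x⁻¹ = -1` and `height x = -x⁻¹`
  set y : ℕ → ℝ := fun k => Real.pi / 2 + k * (2 * Real.pi) with hy
  have hyt : Tendsto y atTop atTop :=
    tendsto_atTop_add_const_left _ _ (tendsto_natCast_atTop_atTop.atTop_mul_const (by positivity))
  have hypos : ∀ k, 0 < y k := fun k => by positivity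
  set x : ℕ → ℝ := fun k => -(y k)⁻¹ with hx
  have hneg : ∀ᶠ k in atTop, x k < 0 :=
    Eventually.of_forall fun k => neg_lt_zero.2 (inv_pos.2 (hypos k))
  have hx0 : Tendsto x atTop (𝓝 0) := by simpa using hyt.inv_tendsto_atTop.neg
  have hinv : ∀ k, (x k)⁻¹ = -y k := fun k => by simp [hx, inv_neg]
  have hab : ∀ k, |(x k)⁻¹| = y k := fun k => by rw [hinv, abs_neg, abs_of_pos (hypos k)]
  have hoff := tendsto_offset (p := p) hneg (by simpa only [hab] using hyt)
  have hht : ∀ k, height (x k) = y k := fun k => by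
    rw [height, hinv, Real.sin_neg, hy, Real.sin_add_nat_mul_two_pi, Real.sin_pi_div_two]
    ring
  have hT : Tendsto (fun k => ‖flow ((x k - p 0) / speed p) p‖) atTop atTop := by
    refine tendsto_atTop_mono (f := fun k => y k
      + -‖Real.exp (logWidth (p 0) - logWidth (x k)) • offset p‖) (fun k => ?_) ?_
    · rw [flow_time hs]
      have h1 : y k ≤ ‖(axis (x k) : Space m)‖ := by
        have := PiLp.norm_apply_le (axis (x k) : Space m) 1
        rw [axis_one, hht, Real.norm_of_nonneg (hypos k).le] at this
        exact this
      have h2 := norm_sub_le_norm_add (axis (x k))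
        (Real.exp (logWidth (p 0) - logWidth (x k)) • offset p)
      linarith
    · exact hyt.atTop_add hoff.norm.neg
  have hT' : Tendsto (fun k => ‖flow ((x k - p 0) / speed p) p‖ₑ) atTop (𝓝 ∞) := by
    simp_rw [← ofReal_norm]
    exact ENNReal.tendsto_ofReal_atTop.comp hT
  refine top_le_iff.1 ?_
  rw [← hT'.limsup_eq]
  exact limsup_le_limsup_of_le (f := map (fun k => (x k - p 0) / speed p) atTop)
    (u := fun t => ‖flow t p‖ₑ) (tendsto_time hs hneg hx0)

lemma liminf_flow {p : Space m} (hs : speed p ≠ 0) :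
    liminf (fun t => ‖flow t p‖ₑ) (𝓝[<] (-p 0 / speed p)) = 0 := by
  -- at these points `height x = 0`
  set y : ℕ → ℝ := fun k => k * Real.pi with hy
  have hyt : Tendsto y atTop atTop := tendsto_natCast_atTop_atTop.atTop_mul_const Real.pi_pos
  set x : ℕ → ℝ := fun k => -(y k)⁻¹ with hx
  have hneg : ∀ᶠ k in atTop, x k < 0 := by
    filter_upwards [hyt.eventually_gt_atTop 0] with k hk
    exact neg_lt_zero.2 (inv_pos.2 hk)
  have hx0 : Tendsto x atTop (𝓝 0) := by simpa using hyt.inv_tendsto_atTop.neg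
  have hinv : ∀ k, (x k)⁻¹ = -y k := fun k => by simp [hx, inv_neg]
  have hoff := tendsto_offset (p := p) hneg (by
    simp only [hinv, abs_neg]; exact tendsto_abs_atTop_atTop.comp hyt)
  have hht : ∀ k, height (x k) = 0 := fun k => by
    rw [height, hinv, Real.sin_neg, hy, Real.sin_nat_mul_pi]
    simp
  have hT : Tendsto (fun k => flow ((x k - p 0) / speed p) p) atTop (𝓝 0) := by
    simp_rw [flow_time hs, axis, hht, zero_smul, add_zero]
    simpa using (hx0.smul_const (EuclideanSpace.single 0 1 : Space m)).add hoff
  have hT' : Tendsto (fun k => ‖flow ((x k - p 0) / speed p) p‖ₑ) atTop (𝓝 0) := by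
    simpa using hT.enorm
  refine le_zero_iff.1 ?_
  rw [← hT'.liminf_eq]
  exact liminf_le_liminf_of_le (f := 𝓝[<] (-p 0 / speed p))
    (g := map (fun k => (x k - p 0) / speed p) atTop)
    (u := fun t => ‖flow t p‖ₑ) (tendsto_time hs hneg hx0)

/-! ### The maximal regular flow -/

lemma isMaximalRegularFlow_flow {T : ℝ} (hT : 0 < T) :
    IsMaximalRegularFlow T (fun _ => field) flow (lifetime T : Space m → ℝ) where
  measurable_time := measurable_lifetime T
  time_pos := lifetime_pos hT
  time_le := lifetime_le T
  measurable_flow := measurable_flow_uncurry.comp measurable_subtype_coe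
  integral_curve := ae_of_all _ fun p =>
    ⟨flow_zero p, fun _ h0 ht => absolutelyContinuousOnInterval_flow h0 ht, by
      filter_upwards [ae_restrict_mem measurableSet_Ioo] with t ht
      exact hasDerivAt_flow fun hp => coord_neg_of_lt_lifetime hp ht.2⟩
  bounded_compression := fun _ hU hb => flow_compression T hU hb
  maximal := ae_of_all _ fun p hp => by
    by_cases hs : speed p = 0
    · simp [lifetime, hs] at hp
    · rw [lifetime, if_neg hs] at hp ⊢
      rw [min_eq_right (((min_lt_iff.1 hp).resolve_left (lt_irrefl T)).le)]
      exact limsup_flow hs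

/-- The part of the core of the tube, where the first coordinate has unit speed, over `(-1, 0)`. -/
def core (m : ℕ) : Set (Space m) := {p | (-1 < p 0 ∧ p 0 < 0) ∧ relDistSq p < 1}

lemma measurableSet_core : MeasurableSet (core m) :=
  ((measurableSet_lt measurable_const (measurable_coord 0)).inter
    (measurableSet_lt (measurable_coord 0) measurable_const)).inter
    (measurableSet_lt measurable_relDistSq measurable_const)

lemma volume_core_pos : 0 < volume (core m) := by
  set q : Space m := axis (-1 / 2) with hq
  have hq0 : q 0 = -1 / 2 := axis_zero _
  refine Measure.measure_pos_of_mem_nhds volume (x := q) ?_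
  have h0 := (contDiffAt_coord (n := 0) 0 q).continuousAt
  have h1 := (contDiffAt_relDistSq (n := 0) (p := q) (by rw [hq0]; norm_num)).continuousAt
  have e1 : ∀ᶠ p : Space m in 𝓝 q, -1 < p 0 :=
    continuousAt_const.eventually_lt h0 (by rw [hq0]; norm_num)
  have e2 : ∀ᶠ p : Space m in 𝓝 q, relDistSq p < 1 :=
    h1.eventually_lt continuousAt_const (by simp [relDistSq, offset, hq0, ← hq])
  filter_upwards [e1, eventually_coord_neg (p := q) (by rw [hq0]; norm_num), e2] with p a b c
  exact ⟨⟨a, b⟩, c⟩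

lemma speed_core {p : Space m} (hp : p ∈ core m) : speed p = 1 := by
  rw [speed_of_neg hp.1.2, cutoff_eq_one hp.2.le]

lemma lifetime_core {T : ℝ} (hT : 2 < T) {p : Space m} (hp : p ∈ core m) :
    lifetime T p = -p 0 := by
  rw [lifetime, speed_core hp, if_neg one_ne_zero, div_one,
    min_eq_right (by linarith [hp.1.1])]

/-! ### Uniqueness of trajectories -/

/-- An absolutely continuous solution of an autonomous differential equation is, along any interval
on which the right-hand side is continuous along the solution, a classical solution. -/
lemma hasDerivWithinAt_of_absolutelyContinuousOnInterval {F : Type*} [NormedAddCommGroup F]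
    [NormedSpace ℝ F] [CompleteSpace F] {Y : ℝ → F} {w : ℝ → F} {a c : ℝ} (hac : a ≤ c)
    (hY : AbsolutelyContinuousOnInterval Y a c) (hw : ContinuousOn w (Icc a c))
    (hd : ∀ᵐ t ∂(volume.restrict (Ioo a c)), HasDerivAt Y (w t) t) {t : ℝ} (ht : t ∈ Ico a c) :
    HasDerivWithinAt Y (w t) (Ici t) t := by
  -- a continuous extension of `w`
  set w' : ℝ → F := IccExtend hac ((Icc a c).domRestrict w) with hw'
  have hw'c : Continuous w' := (continuousOn_iff_continuous_domRestrict.1 hw).Icc_extend'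
  have hw'e : ∀ s ∈ Icc a c, w' s = w s := fun s hs => by
    rw [hw', IccExtend_of_mem _ _ hs, domRestrict_apply]
  set I : ℝ → F := fun s => ∫ r in a..s, w' r with hI
  have hId : ∀ s, HasDerivAt I (w' s) s := fun s =>
    (hw'c.integral_hasStrictDerivAt a s).hasDerivAt
  have hIac : AbsolutelyContinuousOnInterval I a c :=
    ContDiffOn.absolutelyContinuousOnInterval
      (contDiff_one_iff_deriv.2 ⟨fun s => (hId s).differentiableAt, by
        rw [show deriv I = w' from funext fun s => (hId s).deriv]; exact hw'c⟩).contDiffOn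
  obtain ⟨C, hC⟩ := (hY.sub hIac).const_of_ae_hasDerivAt_zero (by
    rw [uIcc_of_le hac]
    have h1 := (ae_restrict_iff' measurableSet_Ioo).1 hd
    filter_upwards [h1, Measure.ae_ne volume a, Measure.ae_ne volume c] with s hs ha hc hs'
    have h2 : s ∈ Ioo a c := ⟨lt_of_le_of_ne hs'.1 (Ne.symm ha), lt_of_le_of_ne hs'.2 hc⟩
    have h3 := (hs h2).sub (hId s)
    rwa [hw'e s hs', sub_self] at h3)
  rw [uIcc_of_le hac] at hC
  have hYI : ∀ s ∈ Icc a c, Y s = I s + C := fun s hs => by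
    rw [← hC s hs]; simp
  have h4 : HasDerivWithinAt (fun s => I s + C) (w t) (Ici t) t := by
    rw [← hw'e t (Ico_subset_Icc_self ht)]
    exact ((hId t).add_const C).hasDerivWithinAt
  refine h4.congr_of_eventuallyEq ?_ (hYI t (Ico_subset_Icc_self ht))
  filter_upwards [Ico_mem_nhdsGE ht.2] with s hs
  exact hYI s ⟨ht.1.trans hs.1, hs.2.le⟩

/-- Uniqueness for an autonomous differential equation, as long as one of the solutions stays in
the set where the right-hand side is continuously differentiable. -/
lemma eqOn_of_ae_hasDerivAt {F : Type*} [NormedAddCommGroup F] [NormedSpace ℝ F]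
    [CompleteSpace F] {v : F → F} {X Y : ℝ → F} {T : ℝ}
    (hX : AbsolutelyContinuousOnInterval X 0 T) (hY : AbsolutelyContinuousOnInterval Y 0 T)
    (hXd : ∀ᵐ t ∂(volume.restrict (Ioo 0 T)), HasDerivAt X (v (X t)) t)
    (hYd : ∀ᵐ t ∂(volume.restrict (Ioo 0 T)), HasDerivAt Y (v (Y t)) t)
    (hv : ∀ t ∈ Icc 0 T, ContDiffAt ℝ 1 v (X t)) (h0 : X 0 = Y 0) (hT : 0 ≤ T) :
    ∀ t ∈ Icc 0 T, X t = Y t := by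
  have hXc := hX.continuousOn
  have hYc := hY.continuousOn
  rw [uIcc_of_le hT] at hXc hYc
  have hcl : IsClosed ({t | X t = Y t} ∩ Icc 0 T) := by
    have : {t | X t = Y t} ∩ Icc 0 T = Icc 0 T ∩ (fun t => X t - Y t) ⁻¹' {0} := by
      ext t; simp [sub_eq_zero, and_comm]
    rw [this]
    exact (hXc.sub hYc).preimage_isClosed_of_isClosed isClosed_Icc isClosed_singleton
  refine hcl.Icc_subset_of_forall_mem_nhdsWithin h0 fun a ⟨hXY, ha⟩ => ?_
  obtain ⟨K, s, hs, hlip⟩ := (hv a (Ico_subset_Icc_self ha)).exists_lipschitzOnWith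
  obtain ⟨s', hs's, hs'o, has'⟩ := mem_nhds_iff.1 hs
  have hIcc : Icc 0 T ∈ 𝓝[≥] a :=
    mem_of_superset (Icc_mem_nhdsGE ha.2) (Icc_subset_Icc_left ha.1)
  have hevX : ∀ᶠ t in 𝓝[≥] a, X t ∈ s' :=
    ((hXc a (Ico_subset_Icc_self ha)).mono_of_mem_nhdsWithin hIcc) (hs'o.mem_nhds has')
  have hevY : ∀ᶠ t in 𝓝[≥] a, Y t ∈ s' :=
    ((hYc a (Ico_subset_Icc_self ha)).mono_of_mem_nhdsWithin hIcc)
      (hs'o.mem_nhds (by rw [← show X a = Y a from hXY]; exact has'))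
  obtain ⟨c, hac, hc⟩ := (mem_nhdsGE_iff_exists_Icc_subset).1
    ((hevX.and hevY).and (Filter.Eventually.filter_mono le_rfl hIcc))
  have hsub : Icc a c ⊆ Icc 0 T := fun t ht => (hc ht).2
  have hIoo : Ioo a c ⊆ Ioo 0 T := fun t ht =>
    ⟨ha.1.trans_lt ht.1, ht.2.trans_le (hsub ⟨hac.le, le_rfl⟩).2⟩
  have hvc : ContinuousOn v s' := hlip.continuousOn.mono hs's
  have hu : uIcc a c ⊆ uIcc 0 T := by
    rw [uIcc_of_le hac.le, uIcc_of_le hT]; exact hsub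
  have huniq := ODE_solution_unique_of_mem_Icc_right (v := fun _ => v) (s := fun _ => s')
    (fun _ _ => hlip.mono hs's) (hXc.mono hsub)
    (fun t ht => hasDerivWithinAt_of_absolutelyContinuousOnInterval hac.le (hX.mono hu)
      (w := fun t => v (X t)) (hvc.comp (hXc.mono hsub) fun t ht => (hc ht).1.1)
      (ae_restrict_of_ae_restrict_of_subset hIoo hXd) ht)
    (fun t ht => (hc (Ico_subset_Icc_self ht)).1.1) (hYc.mono hsub)
    (fun t ht => hasDerivWithinAt_of_absolutelyContinuousOnInterval hac.le (hY.mono hu)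
      (w := fun t => v (Y t)) (hvc.comp (hYc.mono hsub) fun t ht => (hc ht).1.2)
      (ae_restrict_of_ae_restrict_of_subset hIoo hYd) ht)
    (fun t ht => (hc (Ico_subset_Icc_self ht)).1.2) hXY
  exact mem_of_superset (Icc_mem_nhdsGT hac) huniq

/-- Every maximal regular flow of `field` coincides, on the trajectories which start in the core,
with `flow`: as trajectories of `field` are unique, two different existence times would contradict
either the blow-up of `flow` or that of the given flow. -/
lemma eq_flow_of_isMaximalRegularFlow {T : ℝ} (hT : 2 < T) {Y : ℝ → Space m → Space m}
    {τ : Space m → ℝ} (hY : IsMaximalRegularFlow T (fun _ => field) Y τ) :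
    ∀ᵐ p ∂(volume : Measure (Space m)), p ∈ core m →
      τ p = -p 0 ∧ ∀ t ∈ Ico 0 (τ p), flow t p = Y t p := by
  filter_upwards [hY.integral_curve, hY.maximal] with p ⟨hY0, hYac, hYd⟩ hmax hp
  have hs : speed p = 1 := speed_core hp
  have hτ0 := hY.time_pos p
  have hσ0 : 0 < -p 0 := neg_pos.2 hp.1.2
  have hneg : ∀ t < -p 0, p 0 < 0 → p 0 + speed p * t < 0 := fun t ht _ => by
    rw [hs]; linarith
  have heq : ∀ t, 0 ≤ t → t < τ p → t < -p 0 → flow t p = Y t p := by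
    intro t h0 ht1 ht2
    refine eqOn_of_ae_hasDerivAt (v := field) (X := fun s => flow s p) (Y := fun s => Y s p)
      (absolutelyContinuousOnInterval_flow (T := T) h0 (by rwa [lifetime_core hT hp]))
      (hYac t h0 ht1) ?_ ?_ (fun s hs' => ?_) ((flow_zero p).trans hY0.symm) h0 t ⟨h0, le_rfl⟩
    · filter_upwards [ae_restrict_mem measurableSet_Ioo] with s hs'
      exact hasDerivAt_flow (hneg s (hs'.2.trans ht2))
    · exact ae_restrict_of_ae_restrict_of_subset (Ioo_subset_Ioo_right ht1.le) hYd
    · refine contDiffAt_field (n := 1) ?_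
      rw [flow_coord_zero hp.1.2]
      exact hneg s (hs'.2.trans_lt ht2) hp.1.2
  have hlim : limsup (fun t => ‖flow t p‖ₑ) (𝓝[<] (-p 0)) = ∞ := by
    have := limsup_flow (p := p) (by rw [hs]; exact one_ne_zero)
    rwa [hs, div_one] at this
  rcases lt_trichotomy (τ p) (-p 0) with h | h | h
  · exfalso
    have h1 := hmax (h.trans (by linarith [hp.1.1]))
    have h2 : (fun t => ‖Y t p‖ₑ) =ᶠ[𝓝[<] (τ p)] fun t => ‖flow t p‖ₑ := by
      filter_upwards [Ioo_mem_nhdsLT hτ0] with t ht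
      rw [heq t ht.1.le ht.2 (ht.2.trans h)]
    have h3 : Tendsto (fun t => ‖flow t p‖ₑ) (𝓝[<] (τ p)) (𝓝 ‖flow (τ p) p‖ₑ) :=
      ((hasDerivAt_flow (hneg _ h)).continuousAt.tendsto.mono_left nhdsWithin_le_nhds).enorm
    rw [limsup_congr h2, h3.limsup_eq] at h1
    exact enorm_ne_top h1
  · exact ⟨h, fun t ht => heq t ht.1 ht.2 (ht.2.trans_eq h)⟩
  · exfalso
    have h2 : (fun t => ‖flow t p‖ₑ) =ᶠ[𝓝[<] (-p 0)] fun t => ‖Y t p‖ₑ := by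
      filter_upwards [Ioo_mem_nhdsLT hσ0] with t ht
      rw [heq t ht.1.le (ht.2.trans h) ht.2]
    have h3 := (hYac (-p 0) hσ0.le h).continuousOn
    rw [uIcc_of_le hσ0.le] at h3
    have h4 : Tendsto (fun t => ‖Y t p‖ₑ) (𝓝[<] (-p 0)) (𝓝 ‖Y (-p 0) p‖ₑ) :=
      ((h3 (-p 0) ⟨hσ0.le, le_rfl⟩).tendsto.mono_left
        (nhdsWithin_le_iff.2 (mem_of_superset (Ioo_mem_nhdsLT hσ0) Ioo_subset_Icc_self))).enorm
    rw [limsup_congr h2, h4.limsup_eq] at hlim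
    exact enorm_ne_top hlim

/-- The behaviour of the trajectories which start in the core. -/
lemma flow_core {p : Space m} (hp : p ∈ core m) :
    -p 0 ≤ 2 ∧ liminf (fun t => ‖flow t p‖ₑ) (𝓝[<] (-p 0)) = 0 ∧
      limsup (fun t => ‖flow t p‖ₑ) (𝓝[<] (-p 0)) = ∞ := by
  have hs : speed p = 1 := speed_core hp
  have hs' : speed p ≠ 0 := by rw [hs]; exact one_ne_zero
  refine ⟨by linarith [hp.1.1], ?_, ?_⟩
  · simpa [hs] using liminf_flow hs'
  · simpa [hs] using limsup_flow hs'

end OscillatingTube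

theorem proposition7p3 (d : ℕ) (hd : 3 ≤ d) :
    ∃ (b : EuclideanSpace ℝ (Fin d) → EuclideanSpace ℝ (Fin d))
      (S : Set (EuclideanSpace ℝ (Fin d))),
      Measurable b ∧ MeasurableSet S ∧ 0 < volume S ∧
      (∃ p : ℝ, 1 < p ∧ MemSobolevLoc (ENNReal.ofReal p) b) ∧
      HasLocallyBoundedDiv b ∧
      ∀ T : ℝ, 2 < T →
        (∃ (X : ℝ → EuclideanSpace ℝ (Fin d) → EuclideanSpace ℝ (Fin d))
          (τ : EuclideanSpace ℝ (Fin d) → ℝ),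
          IsMaximalRegularFlow T (fun _ => b) X τ ∧
          ∀ x ∈ S, τ x ≤ 2 ∧
            liminf (fun t => ‖X t x‖ₑ) (𝓝[<] τ x) = 0 ∧
            limsup (fun t => ‖X t x‖ₑ) (𝓝[<] τ x) = ∞) ∧
        (∀ (X : ℝ → EuclideanSpace ℝ (Fin d) → EuclideanSpace ℝ (Fin d))
          (τ : EuclideanSpace ℝ (Fin d) → ℝ),
          IsMaximalRegularFlow T (fun _ => b) X τ →
          ∀ᵐ x ∂(volume : Measure (EuclideanSpace ℝ (Fin d))), x ∈ S →
            τ x ≤ 2 ∧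
            liminf (fun t => ‖X t x‖ₑ) (𝓝[<] τ x) = 0 ∧
            limsup (fun t => ‖X t x‖ₑ) (𝓝[<] τ x) = ∞) := by
  obtain ⟨m, rfl⟩ : ∃ m, d = m + 3 := ⟨d - 3, by omega⟩
  refine ⟨OscillatingTube.field, OscillatingTube.core m, OscillatingTube.measurable_field,
    OscillatingTube.measurableSet_core, OscillatingTube.volume_core_pos,
    ⟨4 / 3, by norm_num, OscillatingTube.memSobolevLoc_field⟩,
    OscillatingTube.hasLocallyBoundedDiv_field, fun T hT => ⟨⟨OscillatingTube.flow,
      OscillatingTube.lifetime T, OscillatingTube.isMaximalRegularFlow_flow (by linarith),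
      fun p hp => ?_⟩, fun Y τ hY => ?_⟩⟩
  · rw [OscillatingTube.lifetime_core hT hp]
    exact OscillatingTube.flow_core hp
  · filter_upwards [OscillatingTube.eq_flow_of_isMaximalRegularFlow hT hY] with p hp hpc
    obtain ⟨h1, h2⟩ := hp hpc
    have h3 : (fun t => ‖Y t p‖ₑ) =ᶠ[𝓝[<] (τ p)] fun t => ‖OscillatingTube.flow t p‖ₑ := by
      filter_upwards [Ioo_mem_nhdsLT (hY.time_pos p)] with t ht
      rw [h2 t ⟨ht.1.le, ht.2⟩]
    rw [liminf_congr h3, limsup_congr h3, h1]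
    exact OscillatingTube.flow_core hpc
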